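/- Let $M$ be a smooth $n$-dimensional manifold (Hausdorff, second countable). An order $r$ weighting of $M$, with weights $0\le w_1\le\cdots\le w_n\le r$, is a decreasing filtration $C^\infty_M=C^\infty_{M,(0)}\supseteq C^\infty_{M,(1)}\supseteq\cdots$ of the sheaf of smooth functions by ideal sheaves, such that every point of $M$ has an open neighbourhood $U$ with coordinates $x_1,\dots,x_n$ for which, for all $i$, $C^\infty(U)_{(i)}$ is the ideal generated by the monomials $x_1^{s_1}\cdots x_n^{s_n}$ with $\sum_a s_aw_a\ge i$. It is a weighting along the closed subset $N\subseteq M$ (which is then a submanifold) if $C^\infty_{M,(1)}$ is the vanishing ideal sheaf of $N$. Put $k_i=\#\{a : w_a\le i\}$, and for $m\in N$ let $\tilde F_{-i}|_m\subseteq T_mM$ be the common kernel of the differentials $df|_m$ of all $f\in C^\infty(M)_{(i+1)}$. Let $\mathbb A_r=\mathbb R[\epsilon]/(\epsilon^{r+1})$, and let $T_rM=\mathrm{Hom}_{\mathrm{alg}}(C^\infty(M),\mathbb A_r)$ be the $r$-th tangent bundle. A function $f\in C^\infty(M)$ has the lifts $f^{(j)}:T_rM\to\mathbb R$, $0\le j\le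 r$, with $\mathsf u(f)=\sum_j f^{(j)}(\mathsf u)\epsilon^j$; the smooth structure of $T_rM$ is the one generated by the lifts. The monoid $\Lambda_r=\mathrm{Hom}_{\mathrm{alg}}(\mathbb A_r,\mathbb A_r)$ acts on $T_rM$ by composition, and $t\in(\mathbb R,\cdot)$ acts through $\kappa_t:\epsilon\mapsto t\epsilon$. Regard $M$ as a submanifold of $T_rM$ by means of the constant jets $0_m$, $0_m(f)=f(m)$. A graded subbundle of $T_rM$ over $N$ is an embedded submanifold $Q\subseteq T_rM$ with $\kappa_t(Q)\subseteq Q$ for all $t$ and $\kappa_0(Q)=N$. Identify $T_{0_m}(T_rM)$ with $(T_mM)^{\oplus(r+1)}$ by letting $(X_0,\dots,X_r)$ be the tangent vector that takes each $f^{(j)}$ to $X_j(f)$; the tangent space of $M$ is the summand $X_0$, so that the linear approximation $(T_rM)_{\mathrm{lin}}=\nu(T_rM,M)$ is $TM^{\oplus r}$, with $X_j$ in degree $-j$. The linear approximation of a graded subbundle $Q$ over $N$ is $Q_{\mathrm{lin}}=\nu(Q,N)=TQ|_N/TN$, which maps naturally to $TM^{\oplus r}|_N$. **Theorem.** For an order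 $r$ weighting of $M$ along $N$, let $$Q=\{\mathsf u\in T_rM : f^{(j)}(\mathsf u)=0\ \text{ whenever } f\in C^\infty(M)_{(i)},\ j<i\le r\}.$$ (a) $Q$ is a graded subbundle of $T_rM$ over $N$, of dimension $k_0+k_1+\cdots+k_r$. Moreover, $Q$ is $\Lambda_r$-invariant. (b) The natural map $Q_{\mathrm{lin}}\to TM^{\oplus r}|_N$ is injective, and its image is $\tilde F_{-1}\oplus\cdots\oplus\tilde F_{-r}$. In particular, if $r\ge1$, then $Q_{\mathrm{lin}}^{-r}=TM|_N$. (c) The weighting is recovered from $Q$: for $i\le r$, $$C^\infty(M)_{(i)}=\{f\in C^\infty(M) : f^{(j)}\text{ vanishes on } Q\text{ for all } j<i\}.$$ -/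

import Mathlib

open scoped Manifold ContDiff
open TopologicalSpace

noncomputable section

namespace WeightedJets

/-! ### Weightings -/

section Weightings

variable {n : ℕ} {M : Type*} [TopologicalSpace M] [ChartedSpace (EuclideanSpace ℝ (Fin n)) M]

/-- For a chart `e` of `M` with domain `U` and coordinates `x_1, …, x_n`, the ideal of `C^∞(U)`
generated by the monomials `x^s = ∏ x_a ^ s_a` with `s · w = ∑ s_a w_a ≥ i`. -/
def coordIdeal (w : Fin n → ℕ) (e : OpenPartialHomeomorph M (EuclideanSpace ℝ (Fin n))) (i : ℕ) :
    Ideal C^∞⟮𝓡 n, (⟨e.source, e.open_source⟩ : Opens M); ℝ⟯ :=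
  Ideal.span {g | ∃ s : Fin n → ℕ, i ≤ ∑ a, s a * w a ∧
    ∀ p : (⟨e.source, e.open_source⟩ : Opens M), g p = ∏ a, (e (p : M) a) ^ s a}

variable (n M) in
/-- An order `r` weighting of the `n`-dimensional manifold `M`: a weight sequence
`0 ≤ w_1 ≤ … ≤ w_n ≤ r`, together with a decreasing filtration of the sheaf of smooth functions by
ideal sheaves that near every point is the filtration by `coordIdeal` in suitable (`weighted`)
coordinates of the smooth structure. -/
structure Weighting [IsManifold (𝓡 n) ∞ M] (r : ℕ) where
  /-- the weight sequence -/
  w : Fin n → ℕ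
  w_mono : Monotone w
  w_le : ∀ a, w a ≤ r
  /-- `fil i U` is the ideal `C^∞(U)_{(i)}` -/
  fil : ℕ → (U : Opens M) → Ideal C^∞⟮𝓡 n, U; ℝ⟯
  fil_zero : ∀ U, fil 0 U = ⊤
  fil_succ_le : ∀ i U, fil (i + 1) U ≤ fil i U
  fil_restrict : ∀ i {V U : Opens M} (h : V ≤ U), ∀ f ∈ fil i U,
    ContMDiffMap.restrictRingHom (𝓡 n) 𝓘(ℝ) ℝ h f ∈ fil i V
  fil_local : ∀ i (U : Opens M) (f : C^∞⟮𝓡 n, U; ℝ⟯),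
    (∀ p ∈ U, ∃ (V : Opens M) (h : V ≤ U), p ∈ V ∧
      ContMDiffMap.restrictRingHom (𝓡 n) 𝓘(ℝ) ℝ h f ∈ fil i V) → f ∈ fil i U
  exists_chart : ∀ p : M, ∃ e ∈ IsManifold.maximalAtlas (𝓡 n) ∞ M, p ∈ e.source ∧
    ∀ i, fil i ⟨e.source, e.open_source⟩ = coordIdeal w e i

namespace Weighting

variable [IsManifold (𝓡 n) ∞ M] {r : ℕ} (W : Weighting n M r)

/-- `k_i`, the number of weights that are `≤ i`. -/
def k (i : ℕ) : ℕ := (Finset.univ.filter fun a => W.w a ≤ i).card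

/-- The global function `f` has filtration degree `i`, that is, `f ∈ C^∞(M)_{(i)}`. -/
def HasDegree (i : ℕ) (f : C^∞⟮𝓡 n, M; ℝ⟯) : Prop :=
  f.comp (⟨Subtype.val, contMDiff_subtype_val⟩ : C^∞⟮𝓡 n, (⊤ : Opens M); 𝓡 n, M⟯) ∈ W.fil i ⊤

/-- `W` is a weighting along the closed subset `N`: its degree one part `C^∞_{M,(1)}` is the
vanishing ideal sheaf of `N`. (The local model makes `N` a submanifold of dimension `k_0`.) -/
def IsAlong (N : Set M) : Prop :=
  IsClosed N ∧ ∀ (U : Opens M) (f : C^∞⟮𝓡 n, U; ℝ⟯), f ∈ W.fil 1 U ↔ ∀ p : U, (p : M) ∈ N → f p = 0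

/-- The fibre at `m` of `F̃_{-i} ⊆ TM|_N`, for `m` in `N`. The subbundle `F_{-i}` of the normal bundle
`ν(M, N) = TM|_N / TN` is the one whose annihilator is spanned by the differentials of the functions
of filtration degree `i + 1`, and `F̃_{-i}` is its preimage in `TM|_N`: the common kernel of these
differentials. -/
def Ftilde (i : ℕ) (m : M) : Submodule ℝ (TangentSpace (𝓡 n) m) :=
  ⨅ (f : C^∞⟮𝓡 n, M; ℝ⟯) (_ : W.HasDegree (i + 1) f),
    LinearMap.ker (mfderiv (𝓡 n) 𝓘(ℝ) f m).toLinearMap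

end Weighting

end Weightings

/-! ### The `r`-th tangent bundle -/

/-- The truncated polynomial algebra `ℝ[ε] / (ε ^ (r + 1))`. -/
abbrev TruncAlg (r : ℕ) : Type := AdjoinRoot ((Polynomial.X : Polynomial ℝ) ^ (r + 1))

/-- The generator `ε`. -/
def eps (r : ℕ) : TruncAlg r := AdjoinRoot.root _

lemma eps_pow (r : ℕ) : eps r ^ (r + 1) = 0 := by
  have h := AdjoinRoot.eval₂_root ((Polynomial.X : Polynomial ℝ) ^ (r + 1))
  simpa [eps] using h

/-- The coefficient of `ε ^ j` in an element `∑ a_j ε ^ j`, `0 ≤ j ≤ r`, of `ℝ[ε] / (ε ^ (r + 1))`. -/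
def TruncAlg.coeff {r : ℕ} (j : ℕ) (a : TruncAlg r) : ℝ :=
  (AdjoinRoot.modByMonicHom (Polynomial.monic_X_pow (R := ℝ) (r + 1)) a).coeff j

/-- The monoid `Λ_r` of algebra endomorphisms of `ℝ[ε] / (ε ^ (r + 1))`. -/
abbrev Lam (r : ℕ) : Type := TruncAlg r →ₐ[ℝ] TruncAlg r

/-- The element `ε ↦ t ε`, i.e. `∑ a_j ε ^ j ↦ ∑ a_j t ^ j ε ^ j`, of `Λ_r`. -/
def scaling (r : ℕ) (t : ℝ) : Lam r :=
  AdjoinRoot.liftAlgHom _ (Algebra.ofId ℝ (TruncAlg r)) (t • eps r) (by simp [smul_pow, eps_pow])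

section Jets

variable {n : ℕ} (r : ℕ) (M : Type*) [TopologicalSpace M]
  [ChartedSpace (EuclideanSpace ℝ (Fin n)) M]

variable (n) in
/-- The `r`-th tangent bundle `T_r M`: the algebra morphisms `C^∞(M) → ℝ[ε] / (ε ^ (r + 1))`. -/
abbrev TJet : Type _ := C^∞⟮𝓡 n, M; ℝ⟯ →ₐ[ℝ] TruncAlg r

variable {r M}

/-- The lift `f^{(j)} : T_r M → ℝ` of a function `f`: the value at `u = ∑ u_j ε ^ j` is `u_j(f)`. -/
def lift (f : C^∞⟮𝓡 n, M; ℝ⟯) (j : ℕ) (u : TJet n r M) : ℝ := (u f).coeff j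

/-- The topology of `T_r M`: the coarsest one for which all the lifts `f^{(j)}` are continuous. -/
instance : TopologicalSpace (TJet n r M) :=
  TopologicalSpace.induced
    (fun u => fun q : C^∞⟮𝓡 n, M; ℝ⟯ × Fin (r + 1) => lift q.1 q.2 u) inferInstance

/-- The constant jet at `m`; this is the zero section `M → T_r M`. -/
def zeroJet (m : M) : TJet n r M :=
  { (Algebra.ofId ℝ (TruncAlg r)).toRingHom.comp (ContMDiffMap.evalRingHom m) with
    commutes' := fun _ => rfl }

/-- The action `κ_t` of `(ℝ, ·)`, `∑ u_j ε ^ j ↦ ∑ u_j t ^ j ε ^ j`. -/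
def kappa (t : ℝ) (u : TJet n r M) : TJet n r M := (scaling r t).comp u

/-- The charts of the smooth structure of `T_r M`, with values in `ℝ^{n(r+1)}`. The smooth structure
is the one generated by the lifts `f^{(j)}`, `0 ≤ j ≤ r`: in a chart all lifts are smooth, and,
conversely, the coordinates of a chart are locally smooth functions of finitely many lifts. (For
coordinates `x_a` of `M`, the functions `x_a^{(j)}` are such a chart.) -/
def IsSmoothChart (e : OpenPartialHomeomorph (TJet n r M) (Fin n × Fin (r + 1) → ℝ)) : Prop :=
  (∀ (f : C^∞⟮𝓡 n, M; ℝ⟯) (j : Fin (r + 1)),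
    ContDiffOn ℝ ∞ (fun y => lift f j (e.symm y)) e.target) ∧
  ∀ u ∈ e.source, ∀ c, ∃ (l : ℕ) (q : Fin l → C^∞⟮𝓡 n, M; ℝ⟯ × Fin (r + 1)) (G : (Fin l → ℝ) → ℝ),
    ContDiff ℝ ∞ G ∧ ∀ᶠ v in nhds u, e v c = G fun b => lift (q b).1 (q b).2 v

/-- `Q` is an embedded submanifold of `T_r M` of dimension `d`: near each of its points there is a
chart of `T_r M` in which `Q` is a `d`-dimensional coordinate subspace. -/
def IsSubmanifold (Q : Set (TJet n r M)) (d : ℕ) : Prop :=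
  ∀ u ∈ Q, ∃ e : OpenPartialHomeomorph (TJet n r M) (Fin n × Fin (r + 1) → ℝ),
    IsSmoothChart e ∧ u ∈ e.source ∧ ∃ S : Finset (Fin n × Fin (r + 1)), S.card = d ∧
      ∀ v ∈ e.source, v ∈ Q ↔ ∀ c ∉ S, e v c = 0

/-- `Q` is a graded subbundle of `T_r M`, of (total) dimension `d`, over `N ⊆ M`: an `(ℝ, ·)`-invariant
submanifold whose base `κ_0(Q)` is `N`, regarded as a subset of the zero section. -/
def IsGradedSubbundle (Q : Set (TJet n r M)) (N : Set M) (d : ℕ) : Prop :=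
  IsSubmanifold Q d ∧ (∀ t : ℝ, ∀ u ∈ Q, kappa t u ∈ Q) ∧ kappa 0 '' Q = zeroJet '' N

/-- Smooth curves in `T_r M`. -/
def IsSmoothCurve (γ : ℝ → TJet n r M) : Prop :=
  ∀ (f : C^∞⟮𝓡 n, M; ℝ⟯) (j : Fin (r + 1)), ContDiff ℝ ∞ fun t => lift f j (γ t)

/-- The tangent space at `0_m` (the constant jet at `m`) of a subset `Q ⊆ T_r M`, as a subset of
`T_{0_m}(T_r M) = (T_m M)^{⊕(r+1)}`: the velocities at `0` of the smooth curves in `Q` through `0_m`.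
Here `(X_0, …, X_r)` stands for the tangent vector of `T_r M` at `0_m` that takes the
lift `f^{(j)}` to `X_j(f)`, that is, for `∑ X_j^{(-j)}` at `0_m`, with `X^{(-j)}` the vector field on
`T_r M` that is characterized by `X^{(-j)} f^{(l)} = (X f)^{(l-j)}`. -/
def tangentAtZero (Q : Set (TJet n r M)) (m : M) : Set (Fin (r + 1) → TangentSpace (𝓡 n) m) :=
  {X | ∃ γ : ℝ → TJet n r M, IsSmoothCurve γ ∧ (∀ t, γ t ∈ Q) ∧ γ 0 = zeroJet m ∧
    ∀ (f : C^∞⟮𝓡 n, M; ℝ⟯) (j : Fin (r + 1)),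
      deriv (fun t => lift f j (γ t)) 0 = (mfderiv (𝓡 n) 𝓘(ℝ) f m (X j) : ℝ)}

/-- The fibre at `m` of the linear approximation `Q_lin = ν(Q, N)` of a graded subbundle
`Q ⊆ T_r M` over `N`, inside `(T_r M)_lin = ν(T_r M, M) = TM^{⊕r}`: the image of the tangent space of
`Q` at `0_m` in `T_{0_m}(T_r M) / T_m M = (T_m M)^{⊕(r+1)} / T_m M`, where the zero section
contributes the summand `X_0`. The entry `v j` is the component in degree `-(j + 1)`. -/
def linApprox (Q : Set (TJet n r M)) (m : M) : Set (Fin r → TangentSpace (𝓡 n) m) :=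
  {v | ∃ X ∈ tangentAtZero Q m, ∀ j : Fin r, X j.succ = v j}

/-- The subset `Q ⊆ T_r M` determined by an order `r` weighting. -/
def Weighting.Q [IsManifold (𝓡 n) ∞ M] (W : Weighting n M r) : Set (TJet n r M) :=
  {u | ∀ i ≤ r, ∀ f : C^∞⟮𝓡 n, M; ℝ⟯, W.HasDegree i f → ∀ j < i, lift f j u = 0}

end Jets

end WeightedJets

end

/-!
The proof works with jets in coordinates. Every character of `C^∞(M)` is the evaluation at a point
(`exists_eq_eval`), so a jet `u ∈ T_r M` has a base point `pt u`; it only depends on germs there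
(`apply_eq_of_eventuallyEq`) and, by Hadamard's lemma, on the values of `u` on coordinates
(`jet_eq`). Conversely the values on coordinates can be prescribed: the jet along the curve
`∑ ξ_j t ^ j` of a function is given by the iterates of a total derivative in the variables `ξ_{a,j}`
(`taylorCoeff`), which makes it plain that it depends smoothly on `ξ` and, by Leibniz' rule, that it
is an algebra morphism. So the lifts `x_a^{(j)}` of coordinates of `M` are a chart of `T_r M`
(`ExtChart.jetChart`, `ExtChart.isSmoothChart_jetChart`).

For weighted coordinates, `u ∈ Q` if and only if `u(x_a)` is a multiple of `ε ^ w_a` for all `a`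
(`Weighting.IsWeighted.mem_Q_iff`): if this holds, then a monomial `x ^ s` has values in the
multiples of `ε ^ (s · w)`. In the chart above, `Q` is thus the coordinate subspace `x_a^{(j)} = 0`,
`j < w_a`, and it is a submanifold of dimension `∑_j #{a : w_a ≤ j}`. It is invariant under `Λ_r`
because endomorphisms of `ℝ[ε] / (ε ^ (r + 1))` preserve the ideals `(ε ^ i)`. The same coordinates
give the tangent space of `Q` at a constant jet `0_m`: a curve in `Q` satisfies the equations of
`Q`, including those of filtration degree `r + 1`, and conversely the straight lines in the
coordinate subspace realize all vectors `X` with `X_j ∈ F̃_{-j}`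
(`Weighting.mem_tangentAtZero_iff`); that the velocity of such a line is `X` on all lifts follows
from its being a derivation.

To recover the weighting from `Q`, suppose that the lifts `f^{(j)}` with `j ≤ i` vanish on `Q`. By
induction `f` is locally a combination of monomials of degree at least `i`, and only the terms
`h_s x ^ s` of degree `s · w = i` matter. Along the weighted curves `x_a = z_a t ^ w_a` through a point
of `N`, which define jets in `Q`, the coefficient of `t ^ i` is the polynomial `∑ h_s z ^ s` in `z`.
It vanishes, so that the `h_s` vanish along `N`, and by Hadamard's lemma they are combinations of
the coordinates of positive weight (`Weighting.IsWeighted.exists_mem_monIdeal`).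
-/

noncomputable section

namespace WeightedJets

/-! ### The truncated polynomial algebra -/

namespace TruncAlg

open Polynomial

variable {r : ℕ}

lemma coeff_mk (p : ℝ[X]) (j : ℕ) :
    coeff j (AdjoinRoot.mk _ p : TruncAlg r) = if j < r + 1 then p.coeff j else 0 := by
  have hX := monic_X_pow (R := ℝ) (r + 1)
  rw [coeff, AdjoinRoot.modByMonicHom_mk]
  split_ifs with h
  · have := congrArg (fun q => q.coeff j) (modByMonic_add_div p (X ^ (r + 1)))
    simpa [coeff_X_pow_mul', Nat.not_le.2 h] using this
  · apply coeff_eq_zero_of_degree_lt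
    refine (degree_modByMonic_lt p hX).trans_le ?_
    rw [degree_X_pow]
    exact_mod_cast Nat.not_lt.1 h

lemma mk_surjective (a : TruncAlg r) : ∃ p : ℝ[X], AdjoinRoot.mk _ p = a :=
  AdjoinRoot.mk_surjective a

lemma coeff_of_lt {j : ℕ} (h : r < j) (a : TruncAlg r) : coeff j a = 0 := by
  obtain ⟨p, rfl⟩ := mk_surjective a
  rw [coeff_mk, if_neg (by omega)]

lemma ext_coeff {a b : TruncAlg r} (h : ∀ j ≤ r, coeff j a = coeff j b) : a = b := by
  refine (AdjoinRoot.mk_leftInverse (monic_X_pow (R := ℝ) (r + 1))).injective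
    (Polynomial.ext fun j => ?_)
  change coeff j a = coeff j b
  rcases le_or_gt j r with hj | hj
  · exact h j hj
  · rw [coeff_of_lt hj, coeff_of_lt hj]

variable (r) in
/-- The coefficient of `ε ^ j` as a linear form. -/
def coeffₗ (j : ℕ) : TruncAlg r →ₗ[ℝ] ℝ :=
  (lcoeff ℝ j).comp (AdjoinRoot.modByMonicHom (monic_X_pow (R := ℝ) (r + 1)))

lemma coeffₗ_apply (j : ℕ) (a : TruncAlg r) : coeffₗ r j a = coeff j a := rfl

@[simp] lemma coeff_zero (j : ℕ) : coeff j (0 : TruncAlg r) = 0 := map_zero (coeffₗ r j)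

lemma coeff_add (j : ℕ) (a b : TruncAlg r) : coeff j (a + b) = coeff j a + coeff j b :=
  map_add (coeffₗ r j) a b

lemma coeff_smul (j : ℕ) (c : ℝ) (a : TruncAlg r) : coeff j (c • a) = c * coeff j a :=
  map_smul (coeffₗ r j) c a

lemma coeff_sum {ι : Type*} (j : ℕ) (s : Finset ι) (a : ι → TruncAlg r) :
    coeff j (∑ i ∈ s, a i) = ∑ i ∈ s, coeff j (a i) :=
  map_sum (coeffₗ r j) a s

lemma coeff_mul {j : ℕ} (hj : j ≤ r) (a b : TruncAlg r) :
    coeff j (a * b) = ∑ p ∈ Finset.HasAntidiagonal.antidiagonal j, coeff p.1 a * coeff p.2 b := by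
  obtain ⟨p, rfl⟩ := mk_surjective a
  obtain ⟨q, rfl⟩ := mk_surjective b
  rw [← map_mul, coeff_mk, if_pos (by omega), Polynomial.coeff_mul]
  refine Finset.sum_congr rfl fun x hx => ?_
  have := Finset.HasAntidiagonal.mem_antidiagonal.1 hx
  rw [coeff_mk, coeff_mk, if_pos (by omega), if_pos (by omega)]

lemma coeff_algebraMap (j : ℕ) (c : ℝ) :
    coeff j (algebraMap ℝ (TruncAlg r) c) = if j = 0 then c else 0 := by
  have : algebraMap ℝ (TruncAlg r) c = AdjoinRoot.mk _ (C c) := rfl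
  rw [this, coeff_mk, coeff_C]
  split_ifs <;> first | rfl | omega

lemma coeff_one (j : ℕ) : coeff j (1 : TruncAlg r) = if j = 0 then 1 else 0 := by
  rw [← map_one (algebraMap ℝ (TruncAlg r)), coeff_algebraMap]

lemma coeff_zero_mul (a b : TruncAlg r) : coeff 0 (a * b) = coeff 0 a * coeff 0 b := by
  rw [coeff_mul (Nat.zero_le r)]; simp

variable (r) in
/-- The augmentation `∑ a_j ε ^ j ↦ a_0`. -/
def aug : TruncAlg r →ₐ[ℝ] ℝ :=
  AlgHom.ofLinearMap (coeffₗ r 0) (by simp [coeffₗ_apply, coeff_one])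
    (fun a b => coeff_zero_mul a b)

/-- The ideal generated by `ε ^ i`, given by its equations: the coefficients of `ε ^ j` with
`j < i` vanish. -/
def order (r i : ℕ) : Ideal (TruncAlg r) where
  carrier := {a | ∀ j < i, coeff j a = 0}
  zero_mem' := fun j _ => coeff_zero j
  add_mem' := fun {a b} ha hb j hj => by rw [coeff_add, ha j hj, hb j hj, add_zero]
  smul_mem' := fun c a ha j hj => by
    rcases le_or_gt j r with hr | hr
    · rw [smul_eq_mul, coeff_mul hr]
      refine Finset.sum_eq_zero fun x hx => ?_
      have := Finset.HasAntidiagonal.mem_antidiagonal.1 hx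
      rw [ha x.2 (by omega), mul_zero]
    · exact coeff_of_lt hr _

lemma order_zero (a : TruncAlg r) : a ∈ order r 0 := fun _ h => absurd h (Nat.not_lt_zero _)

lemma order_anti {i k : ℕ} (h : i ≤ k) {a : TruncAlg r} (ha : a ∈ order r k) : a ∈ order r i :=
  fun j hj => ha j (hj.trans_le h)

lemma eq_zero_of_mem_order {a : TruncAlg r} (ha : a ∈ order r (r + 1)) : a = 0 :=
  ext_coeff fun j hj => by rw [ha j (by omega), coeff_zero]

lemma mul_mem_order {i k : ℕ} {a b : TruncAlg r} (ha : a ∈ order r i) (hb : b ∈ order r k) :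
    a * b ∈ order r (i + k) := by
  intro j hj
  rcases le_or_gt j r with hr | hr
  · rw [coeff_mul hr]
    refine Finset.sum_eq_zero fun x hx => ?_
    have := Finset.HasAntidiagonal.mem_antidiagonal.1 hx
    rcases lt_or_ge x.1 i with h | h
    · rw [ha _ h, zero_mul]
    · rw [hb x.2 (by omega), mul_zero]
  · exact coeff_of_lt hr _

lemma pow_mem_order {i : ℕ} {a : TruncAlg r} (ha : a ∈ order r i) (k : ℕ) :
    a ^ k ∈ order r (k * i) := by
  induction k with
  | zero => simpa using order_zero (1 : TruncAlg r)
  | succ k ih => rw [pow_succ a, Nat.succ_mul]; exact mul_mem_order ih ha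

lemma prod_mem_order {ι : Type*} (s : Finset ι) {i : ι → ℕ} {a : ι → TruncAlg r}
    (ha : ∀ x ∈ s, a x ∈ order r (i x)) : ∏ x ∈ s, a x ∈ order r (∑ x ∈ s, i x) := by
  classical
  induction s using Finset.induction_on with
  | empty => simpa using order_zero (1 : TruncAlg r)
  | insert x s hx ih =>
    rw [Finset.prod_insert hx, Finset.sum_insert hx]
    exact mul_mem_order (ha x (by simp)) (ih fun y hy => ha y (by simp [hy]))

lemma coeff_eps_pow (i j : ℕ) :
    coeff j (eps r ^ i) = if j = i ∧ j ≤ r then 1 else 0 := by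
  have : eps r ^ i = AdjoinRoot.mk _ (X ^ i) := by rw [map_pow, AdjoinRoot.mk_X]; rfl
  rw [this, coeff_mk, coeff_X_pow]
  split_ifs <;> first | rfl | omega

lemma coeff_mul_eps_pow {i : ℕ} (hi : i ≤ r) (a : TruncAlg r) :
    coeff i (a * eps r ^ i) = coeff 0 a := by
  rw [coeff_mul hi, Finset.sum_eq_single (0, i)]
  · simp [coeff_eps_pow, hi]
  · intro p hp hne
    have := Finset.HasAntidiagonal.mem_antidiagonal.1 hp
    have h2 : p.2 ≠ i := fun h => hne (Prod.ext (by simp; omega) h)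
    simp [coeff_eps_pow, h2]
  · intro h
    exact absurd (Finset.HasAntidiagonal.mem_antidiagonal.2 (zero_add i)) h

/-- The element `∑ a_j ε ^ j` with prescribed coefficients `a_j`, `0 ≤ j ≤ r`. -/
def ofCoeff (r : ℕ) (a : ℕ → ℝ) : TruncAlg r :=
  ∑ j ∈ Finset.range (r + 1), a j • eps r ^ j

lemma coeff_ofCoeff (a : ℕ → ℝ) {j : ℕ} (hj : j ≤ r) : coeff j (ofCoeff r a) = a j := by
  rw [ofCoeff, coeff_sum, Finset.sum_eq_single j]
  · simp [coeff_smul, coeff_eps_pow, hj]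
  · intro i _ hi
    simp [coeff_smul, coeff_eps_pow, hi.symm]
  · intro h
    exact absurd (Finset.mem_range.2 (by omega)) h

/-- An element all of whose coefficients below `i` vanish is a multiple of `ε ^ i`. -/
lemma exists_eq_eps_pow_mul {i : ℕ} {a : TruncAlg r} (ha : a ∈ order r i) :
    ∃ b, a = eps r ^ i * b := by
  obtain ⟨p, rfl⟩ := mk_surjective a
  refine ⟨AdjoinRoot.mk _ (p /ₘ X ^ i), ext_coeff fun j hj => ?_⟩
  have he : eps r ^ i = AdjoinRoot.mk _ (X ^ i) := by rw [map_pow, AdjoinRoot.mk_X]; rfl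
  rw [he, ← map_mul, coeff_mk, coeff_mk, if_pos (by omega), if_pos (by omega)]
  rcases lt_or_ge j i with h | h
  · have := ha j h
    rw [coeff_mk, if_pos (by omega)] at this
    rw [this, coeff_X_pow_mul', if_neg (by omega)]
  · have := congrArg (fun q => q.coeff j) (modByMonic_add_div p (X ^ i))
    have h0 : (p %ₘ X ^ i).coeff j = 0 := by
      apply coeff_eq_zero_of_degree_lt
      refine (degree_modByMonic_lt p (monic_X_pow i)).trans_le ?_
      rw [degree_X_pow]
      exact_mod_cast h
    rw [← this]
    simp only [Polynomial.coeff_add, h0, zero_add]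

/-- Endomorphisms of `ℝ[ε] / (ε ^ (r + 1))` preserve the powers of the maximal ideal: the image of
`ε` is nilpotent, hence has vanishing constant term. -/
lemma map_mem_order (Ψ : Lam r) {i : ℕ} {a : TruncAlg r} (ha : a ∈ order r i) :
    Ψ a ∈ order r i := by
  obtain ⟨b, rfl⟩ := exists_eq_eps_pow_mul ha
  have h1 : Ψ (eps r) ∈ order r 1 := by
    intro j hj
    obtain rfl : j = 0 := by omega
    have h : aug r (Ψ (eps r)) ^ (r + 1) = 0 := by
      rw [← map_pow, ← map_pow, eps_pow, map_zero, map_zero]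
    exact pow_eq_zero_iff (Nat.succ_ne_zero r) |>.1 h
  rw [map_mul, map_pow]
  have := pow_mem_order h1 i
  rw [mul_one] at this
  exact Ideal.mul_mem_right _ _ this

lemma coeff_scaling_zero (j : ℕ) (a : TruncAlg r) :
    coeff j (scaling r 0 a) = if j = 0 then coeff 0 a else 0 := by
  obtain ⟨p, rfl⟩ := mk_surjective a
  have : scaling r 0 (AdjoinRoot.mk _ p) = algebraMap ℝ (TruncAlg r) (p.coeff 0) := by
    rw [scaling, AdjoinRoot.liftAlgHom_mk, zero_smul, eval₂_at_zero]
    rfl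
  rw [this, coeff_algebraMap, coeff_mk, if_pos (Nat.succ_pos r)]

end TruncAlg

/-! ### Hadamard's lemma -/

section Hadamard

variable {E : Type*} [NormedAddCommGroup E] [NormedSpace ℝ E]

open MeasureTheory Convolution in
/-- A smooth function of a parameter and of a real variable stays smooth when it is integrated over
`[0, 1]`: the integral is the value at `0` of a convolution with an indicator function. -/
lemma contDiff_integral_Icc {Φ : E × ℝ → ℝ} (hΦ : ContDiff ℝ ∞ Φ) :
    ContDiff ℝ ∞ fun x => ∫ t in Set.Icc (0 : ℝ) 1, Φ (x, t) := by
  -- the cutoff makes the support in the convolution variable compact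
  let b : ContDiffBump (0 : ℝ) := ⟨1, 2, one_pos, one_lt_two⟩
  let g : E → ℝ → ℝ := fun x t => b t * Φ (x, -t)
  have hg : ContDiffOn ℝ ((⊤ : ℕ∞) : ℕ∞ω) (Function.uncurry g) (Set.univ ×ˢ Set.univ) := by
    apply ContDiff.contDiffOn
    exact (b.contDiff.comp contDiff_snd).mul
      (hΦ.comp (contDiff_fst.prodMk contDiff_snd.neg))
  have hf : LocallyIntegrable (Set.indicator (Set.Icc (0 : ℝ) 1) fun _ => (1 : ℝ)) volume :=
    (locallyIntegrable_const 1).indicator measurableSet_Icc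
  have key := contDiffOn_convolution_right_with_param (ContinuousLinearMap.mul ℝ ℝ)
    (g := g) (s := Set.univ) (k := Metric.closedBall 0 2) isOpen_univ (isCompact_closedBall _ _)
    (fun p x _ hx => by
      have : b x = 0 := b.zero_of_le_dist (by
        simpa using (not_le.1 fun h => hx (Metric.mem_closedBall.2 h)).le)
      simp [g, this]) hf hg
  have h2 : ContDiff ℝ ∞ fun x : E => ((Set.indicator (Set.Icc (0 : ℝ) 1) fun _ => (1 : ℝ))
      ⋆[ContinuousLinearMap.mul ℝ ℝ, volume] g x) 0 := by
    rw [← contDiffOn_univ]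
    exact key.comp (contDiffOn_id.prodMk contDiffOn_const) fun x _ => ⟨trivial, trivial⟩
  convert h2 using 2 with x
  rw [convolution_def, ← integral_indicator measurableSet_Icc]
  congr 1 with t
  by_cases ht : t ∈ Set.Icc (0 : ℝ) 1
  · have : b (-t) = 1 := b.one_of_mem_closedBall (by
      simpa [abs_le] using ⟨by linarith [ht.1], ht.2⟩)
    simp [ht, g, this]
  · simp [ht]

/-- Hadamard's lemma, relative to a smooth self-map `P` of `ℝ ^ n`. If `P` is the projection to a
coordinate subspace, only the coordinates that are constant on it contribute to the sum. -/
theorem hadamard {n : ℕ} {h : EuclideanSpace ℝ (Fin n) → ℝ} (hh : ContDiff ℝ ∞ h)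
    {P : EuclideanSpace ℝ (Fin n) → EuclideanSpace ℝ (Fin n)} (hP : ContDiff ℝ ∞ P) :
    ∃ g : Fin n → EuclideanSpace ℝ (Fin n) → ℝ, (∀ a, ContDiff ℝ ∞ (g a)) ∧
      ∀ x, h x - h (P x) = ∑ a, (x a - P x a) * g a x := by
  let v : Fin n → EuclideanSpace ℝ (Fin n) := fun a => EuclideanSpace.single a 1
  let Φ : Fin n → EuclideanSpace ℝ (Fin n) × ℝ → ℝ :=
    fun a q => fderiv ℝ h (P q.1 + q.2 • (q.1 - P q.1)) (v a)
  have hΦ : ∀ a, ContDiff ℝ ∞ (Φ a) := fun a =>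
    ((hh.fderiv_right (by norm_cast)).comp ((hP.comp contDiff_fst).add
      (contDiff_snd.smul (contDiff_fst.sub (hP.comp contDiff_fst))))).clm_apply contDiff_const
  refine ⟨fun a x => ∫ t in Set.Icc (0 : ℝ) 1, Φ a (x, t), fun a => contDiff_integral_Icc (hΦ a),
    fun x => ?_⟩
  have hint : ∀ a, IntervalIntegrable (fun t => Φ a (x, t)) MeasureTheory.volume 0 1 := fun a =>
    ((hΦ a).continuous.comp (Continuous.prodMk_right x)).intervalIntegrable _ _
  have hd : ∀ t ∈ Set.uIcc (0 : ℝ) 1, HasDerivAt (fun t : ℝ => h (P x + t • (x - P x)))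
      (∑ a, (x a - P x a) * Φ a (x, t)) t := by
    intro t _
    have h1 : HasDerivAt (fun t : ℝ => P x + t • (x - P x)) (x - P x) t := by
      simpa using ((hasDerivAt_id t).smul_const (x - P x)).const_add (P x)
    have h2 := (hh.differentiable (by simp) (P x + t • (x - P x))).hasFDerivAt.comp_hasDerivAt t h1
    have hv : x - P x = ∑ a, (x a - P x a) • v a := by
      simpa [v] using ((EuclideanSpace.basisFun (Fin n) ℝ).sum_repr (x - P x)).symm
    have h3 : fderiv ℝ h (P x + t • (x - P x)) (x - P x) =
        ∑ a, (x a - P x a) * Φ a (x, t) := by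
      conv_lhs => rw [hv, map_sum]
      refine Finset.sum_congr rfl fun a _ => ?_
      rw [map_smul, smul_eq_mul, ← hv]
    rw [h3] at h2
    exact h2
  have := intervalIntegral.integral_eq_sub_of_hasDerivAt hd
    ((continuous_finsetSum _ fun a _ => continuous_const.mul
      ((hΦ a).continuous.comp (Continuous.prodMk_right x))).intervalIntegrable _ _)
  rw [intervalIntegral.integral_finsetSum fun a _ => (hint a).const_mul _] at this
  simp only [one_smul, add_sub_cancel, zero_smul, add_zero] at this
  rw [← this]
  refine Finset.sum_congr rfl fun a _ => ?_
  rw [intervalIntegral.integral_const_mul, intervalIntegral.integral_of_le zero_le_one,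
    ← MeasureTheory.integral_Icc_eq_integral_Ioc]

end Hadamard

/-! ### Smooth functions on a manifold -/

section Manifold

open Filter Topology

lemma locallyCompactSpace_of_charted (n : ℕ) (M : Type*) [TopologicalSpace M]
    [ChartedSpace (EuclideanSpace ℝ (Fin n)) M] : LocallyCompactSpace M :=
  ChartedSpace.locallyCompactSpace (EuclideanSpace ℝ (Fin n)) M

variable {n : ℕ} {M : Type*} [TopologicalSpace M] [ChartedSpace (EuclideanSpace ℝ (Fin n)) M]

lemma eval_sum {ι : Type*} (s : Finset ι) (f : ι → C^∞⟮𝓡 n, M; ℝ⟯) (x : M) :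
    (∑ i ∈ s, f i) x = ∑ i ∈ s, f i x :=
  map_sum (ContMDiffMap.evalRingHom x : C^∞⟮𝓡 n, M; ℝ⟯ →+* ℝ) f s

lemma eval_prod {ι : Type*} (s : Finset ι) (f : ι → C^∞⟮𝓡 n, M; ℝ⟯) (x : M) :
    (∏ i ∈ s, f i) x = ∏ i ∈ s, f i x :=
  map_prod (ContMDiffMap.evalRingHom x : C^∞⟮𝓡 n, M; ℝ⟯ →+* ℝ) f s

lemma eval_pow (f : C^∞⟮𝓡 n, M; ℝ⟯) (k : ℕ) (x : M) : (f ^ k : C^∞⟮𝓡 n, M; ℝ⟯) x = f x ^ k :=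
  map_pow (ContMDiffMap.evalRingHom x : C^∞⟮𝓡 n, M; ℝ⟯ →+* ℝ) f k

variable (n M) in
/-- A chart of the smooth structure together with global functions that extend its coordinates. -/
structure ExtChart where
  /-- the chart -/
  e : OpenPartialHomeomorph M (EuclideanSpace ℝ (Fin n))
  mem_atlas : e ∈ IsManifold.maximalAtlas (𝓡 n) ∞ M
  /-- the extensions of the coordinates -/
  X : Fin n → C^∞⟮𝓡 n, M; ℝ⟯
  X_eq : ∀ a, ∀ q ∈ e.source, X a q = e q a

namespace ExtChart

variable (c : ExtChart n M)

lemma contMDiffOn : ContMDiffOn (𝓡 n) (𝓡 n) ∞ c.e c.e.source :=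
  contMDiffOn_of_mem_maximalAtlas c.mem_atlas

lemma contMDiffOn_symm : ContMDiffOn (𝓡 n) (𝓡 n) ∞ c.e.symm c.e.target :=
  contMDiffOn_symm_of_mem_maximalAtlas c.mem_atlas

lemma contDiffOn_comp_symm (f : C^∞⟮𝓡 n, M; ℝ⟯) : ContDiffOn ℝ ∞ (f ∘ c.e.symm) c.e.target :=
  contMDiffOn_iff_contDiffOn.1 (f.contMDiff.comp_contMDiffOn c.contMDiffOn_symm)

end ExtChart

variable [T2Space M] [SecondCountableTopology M] [IsManifold (𝓡 n) ∞ M]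

lemma exists_bump {p : M} {U : Set M} (hU : IsOpen U) (hp : p ∈ U) :
    ∃ χ : C^∞⟮𝓡 n, M; ℝ⟯, (∀ᶠ q in 𝓝 p, χ q = 1) ∧ tsupport χ ⊆ U := by
  have := locallyCompactSpace_of_charted n M
  obtain ⟨K, hK, hKc, hKU⟩ := exists_mem_nhds_isClosed_subset (hU.mem_nhds hp)
  obtain ⟨f, h1, h0, -⟩ := exists_contMDiffMap_one_nhds_of_subset_interior (𝓡 n)
    (n := ⊤) (isClosed_singleton (x := p))
    (Set.singleton_subset_iff.2 (mem_interior_iff_mem_nhds.2 hK))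
  refine ⟨f, by simpa using h1, ?_⟩
  refine (closure_minimal (fun x hx => ?_) hKc).trans hKU
  by_contra h
  exact hx (h0 x h)

/-- Every germ of a smooth function is the germ of a global smooth function. -/
lemma exists_extension {φ : M → ℝ} {U : Set M} (hU : IsOpen U)
    (hφ : ContMDiffOn (𝓡 n) 𝓘(ℝ) ∞ φ U) {q : M} (hq : q ∈ U) :
    ∃ ψ : C^∞⟮𝓡 n, M; ℝ⟯, ψ =ᶠ[𝓝 q] φ := by
  obtain ⟨χ, h1, hs⟩ := exists_bump (n := n) hU hq
  refine ⟨⟨fun x => χ x * φ x, contMDiff_of_tsupport fun x hx => ?_⟩, ?_⟩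
  · exact χ.contMDiff.contMDiffAt.mul (hφ.contMDiffAt (hU.mem_nhds
      (hs (tsupport_mul_subset_left hx))))
  · filter_upwards [h1] with x hx
    simp [hx]

/-- A germ of a smooth function on an open subset is the germ of a global smooth function. -/
lemma exists_extension_opens {U : Opens M} (φ : C^∞⟮𝓡 n, U; ℝ⟯) {q : M} (hq : q ∈ U) :
    ∃ ψ : C^∞⟮𝓡 n, M; ℝ⟯, ∀ᶠ x in 𝓝 q, ∀ hx : x ∈ U, ψ x = φ ⟨x, hx⟩ := by
  classical
  let φ' : M → ℝ := fun x => if hx : x ∈ U then φ ⟨x, hx⟩ else 0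
  have hφ' : ContMDiffOn (𝓡 n) 𝓘(ℝ) ∞ φ' U := by
    intro x hx
    have : ContMDiffAt (𝓡 n) 𝓘(ℝ) ∞ (fun y : U => φ' y) ⟨x, hx⟩ := by
      convert φ.contMDiff.contMDiffAt (x := ⟨x, hx⟩) using 1
      ext y
      simp [φ']
    exact (contMDiffAt_subtype_iff.1 this).contMDiffWithinAt
  obtain ⟨ψ, hψ⟩ := exists_extension U.isOpen hφ' hq
  refine ⟨ψ, ?_⟩
  filter_upwards [hψ] with x h hx
  simp [h, φ', hx]

namespace ExtChart

variable (c : ExtChart n M)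

/-- Hadamard's lemma: a function that vanishes on a coordinate submanifold is, near each point of
it, a combination of the coordinates that define the submanifold. -/
lemma hadamard (A : Finset (Fin n)) {q : M} (hq : q ∈ c.e.source) (h : C^∞⟮𝓡 n, M; ℝ⟯)
    (hz : ∀ᶠ x in 𝓝 q, (∀ a ∈ A, c.X a x = c.X a q) → h x = 0) :
    ∃ g : Fin n → C^∞⟮𝓡 n, M; ℝ⟯,
      ∀ᶠ x in 𝓝 q, h x = ∑ a ∈ A, (c.X a x - c.X a q) * g a x := by
  classical
  set y₀ := c.e q with hy₀
  have hy₀t : y₀ ∈ c.e.target := c.e.map_source hq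
  -- a global smooth function on `ℝ ^ n` that represents `h` near `q`
  obtain ⟨ρ, hρ1, hρs⟩ := exists_bump (n := n) c.e.open_target hy₀t
  let F : EuclideanSpace ℝ (Fin n) → ℝ := fun y => ρ y * h (c.e.symm y)
  have hF : ContDiff ℝ ∞ F := by
    rw [← contMDiff_iff_contDiff]
    refine contMDiff_of_tsupport fun y hy => ?_
    have hyt : y ∈ c.e.target := hρs (tsupport_mul_subset_left hy)
    exact ρ.contMDiff.contMDiffAt.mul ((contMDiffAt_iff_contDiffAt.2
      ((c.contDiffOn_comp_symm h).contDiffAt (c.e.open_target.mem_nhds hyt))))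
  -- the projection to the coordinate subspace through `y₀`
  let P : EuclideanSpace ℝ (Fin n) → EuclideanSpace ℝ (Fin n) :=
    fun y => WithLp.toLp 2 fun a => if a ∈ A then y₀ a else y a
  have hP : ContDiff ℝ ∞ P := by
    rw [contDiff_euclidean]
    intro a
    by_cases ha : a ∈ A
    · simpa [P, ha] using contDiff_const
    · simp only [P, ha, if_false]
      exact (contDiff_euclidean.1 contDiff_id) a
  have hP0 : P y₀ = y₀ := by ext a; simp [P]
  obtain ⟨G, hG, hFG⟩ := WeightedJets.hadamard hF hP
  have hext : ∀ a, ∃ g : C^∞⟮𝓡 n, M; ℝ⟯, g =ᶠ[𝓝 q] G a ∘ c.e := fun a =>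
    exists_extension c.e.open_source
      ((hG a).contMDiff.comp_contMDiffOn c.contMDiffOn) hq
  choose g hg using hext
  refine ⟨g, ?_⟩
  have hcont : Tendsto c.e (𝓝 q) (𝓝 y₀) := c.e.continuousAt hq
  have hPc : Tendsto (fun x => P (c.e x)) (𝓝 q) (𝓝 y₀) := by
    have := (hP.continuous.tendsto y₀).comp hcont
    rwa [hP0] at this
  have hsymm : Tendsto (fun x => c.e.symm (P (c.e x))) (𝓝 q) (𝓝 q) := by
    have := (c.e.continuousAt_symm hy₀t).tendsto.comp hPc
    rwa [hy₀, c.e.left_inv hq] at this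
  filter_upwards [hcont.eventually hρ1, hPc.eventually (c.e.open_target.mem_nhds hy₀t),
    hsymm.eventually hz, c.e.open_source.mem_nhds hq, eventually_all.2 hg] with x h1 h2 h3 hx hgx
  have hPx : F (P (c.e x)) = 0 := by
    have : h (c.e.symm (P (c.e x))) = 0 := h3 fun a ha => by
      rw [c.X_eq a _ (c.e.map_target h2), c.e.right_inv h2, c.X_eq a _ hq]
      simp [P, ha, hy₀]
    simp [F, this]
  have hFx : F (c.e x) = h x := by simp [F, h1, c.e.left_inv hx]
  have := hFG (c.e x)
  rw [hPx, hFx, sub_zero] at this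
  rw [this, ← Finset.sum_subset (Finset.subset_univ A)]
  · refine Finset.sum_congr rfl fun a ha => ?_
    rw [hgx a, c.X_eq a _ hx, c.X_eq a _ hq]
    simp [P, ha, hy₀]
  · intro a _ ha
    simp [P, ha]

end ExtChart

/-- A derivation at a point is determined by its values on coordinates. -/
lemma pointDerivation_eq_zero (c : ExtChart n M) {m : M} (hm : m ∈ c.e.source)
    (δ : C^∞⟮𝓡 n, M; ℝ⟯ →ₗ[ℝ] ℝ) (hδ : ∀ f g, δ (f * g) = f m * δ g + g m * δ f)
    (hX : ∀ a, δ (c.X a) = 0) : δ = 0 := by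
  have h1 : δ 1 = 0 := by
    have := hδ 1 1
    simp at this
    linarith
  have hconst : ∀ k : ℝ, δ (algebraMap ℝ _ k) = 0 := fun k => by
    rw [Algebra.algebraMap_eq_smul_one, map_smul, h1, smul_zero]
  have hloc : ∀ f : C^∞⟮𝓡 n, M; ℝ⟯, (∀ᶠ x in 𝓝 m, f x = 0) → δ f = 0 := by
    intro f hf
    obtain ⟨U, hU, hUo, hmU⟩ := eventually_nhds_iff.1 hf
    obtain ⟨χ, hχ1, hχs⟩ := exists_bump (n := n) hUo hmU
    have h0 : χ * f = 0 := by
      ext x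
      by_cases hx : x ∈ U
      · simp [hU x hx]
      · have : χ x = 0 := image_eq_zero_of_notMem_tsupport fun h => hx (hχs h)
        simp [this]
    have := hδ χ f
    rw [h0, map_zero, hχ1.self_of_nhds, hf.self_of_nhds] at this
    linarith
  ext f
  obtain ⟨g, hg⟩ := c.hadamard Finset.univ hm (f - algebraMap ℝ _ (f m)) (by
    have hev : ∀ᶠ x in 𝓝 m, x ∈ c.e.source := c.e.open_source.mem_nhds hm
    filter_upwards [hev] with x hx h
    have : c.e x = c.e m := by
      ext a
      rw [← c.X_eq a x hx, ← c.X_eq a m hm, h a (Finset.mem_univ a)]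
    rw [c.e.injOn hx hm this]
    exact sub_self (f m))
  have h2 := hloc (f - algebraMap ℝ _ (f m) -
      ∑ a, (c.X a - algebraMap ℝ _ (c.X a m)) * g a) (by
    filter_upwards [hg] with x hx
    change (f - algebraMap ℝ _ (f m) : C^∞⟮𝓡 n, M; ℝ⟯) x -
      (∑ a, (c.X a - algebraMap ℝ _ (c.X a m)) * g a : C^∞⟮𝓡 n, M; ℝ⟯) x = 0
    rw [hx, sub_eq_zero, eval_sum]
    rfl)
  rw [map_sub, map_sub, hconst, sub_zero, map_sum, sub_eq_zero] at h2
  rw [h2, LinearMap.zero_apply]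
  refine Finset.sum_eq_zero fun a _ => ?_
  rw [hδ, map_sub, hX, hconst]
  have : (c.X a - algebraMap ℝ _ (c.X a m) : C^∞⟮𝓡 n, M; ℝ⟯) m = 0 := sub_self (c.X a m)
  rw [this]
  simp

/-- Every character `φ` of the algebra of smooth functions is the evaluation at a point. Otherwise
finitely many functions `(f - φ(f)) ^ 2` have a positive sum: one of them, for a proper `f`, is
positive outside of a compact set, which finitely many others take care of. The sum is then
invertible, but it is in the kernel of `φ`. -/
theorem exists_eq_eval (φ : C^∞⟮𝓡 n, M; ℝ⟯ →ₐ[ℝ] ℝ) : ∃ p : M, ∀ f, φ f = f p := by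
  have := locallyCompactSpace_of_charted n M
  let K : CompactExhaustion M := default
  -- a smooth function with compact sublevel sets
  obtain ⟨b, hb⟩ := exists_contMDiffMap_forall_mem_convex_of_local_const (𝓡 n) (n := ⊤)
    (t := fun x => Set.Ici (K.find x : ℝ)) (fun x => convex_Ici _) (fun x => by
      refine ⟨(K.find x + 1 : ℕ), ?_⟩
      have hx : K (K.find x + 1) ∈ 𝓝 x :=
        mem_interior_iff_mem_nhds.1 (K.subset_interior_succ _ (K.mem_find x))
      filter_upwards [hx] with y hy
      exact (Nat.cast_le (α := ℝ)).2 (K.mem_iff_find_le.1 hy))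
  by_contra! hcon
  choose f hf using hcon
  have hval : ∀ (g : C^∞⟮𝓡 n, M; ℝ⟯) (x : M), (g - algebraMap ℝ _ (φ g)) x = g x - φ g :=
    fun _ _ => rfl
  let s : C^∞⟮𝓡 n, M; ℝ⟯ → C^∞⟮𝓡 n, M; ℝ⟯ := fun g => (g - algebraMap ℝ _ (φ g)) ^ 2
  have hs : ∀ g, φ (s g) = 0 := fun g => by simp [s]
  have hsx : ∀ g x, s g x = (g x - φ g) ^ 2 := fun g x => by
    rw [eval_pow, hval]
  obtain ⟨N, hN⟩ := exists_nat_ge (φ b)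
  obtain ⟨T, hT⟩ := (K.isCompact N).elim_nhds_subcover (fun p => {x | s (f p) x ≠ 0}) fun p _ =>
    ((s (f p)).contMDiff.continuous.isOpen_preimage _ isOpen_ne).mem_nhds (by
      change s (f p) p ≠ 0
      rw [hsx]
      exact pow_ne_zero 2 (sub_ne_zero.2 (hf p).symm))
  let g : C^∞⟮𝓡 n, M; ℝ⟯ := s b + ∑ p ∈ T, s (f p)
  have hgx : ∀ x, g x = s b x + ∑ p ∈ T, s (f p) x := fun x => by
    change s b x + (∑ p ∈ T, s (f p) : C^∞⟮𝓡 n, M; ℝ⟯) x = _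
    rw [eval_sum]
  have hnn : ∀ g x, 0 ≤ s g x := fun g x => by rw [hsx]; positivity
  have hg : ∀ x, g x ≠ 0 := by
    intro x hx
    rw [hgx, add_eq_zero_iff_of_nonneg (hnn _ _) (Finset.sum_nonneg fun p _ => hnn _ _),
      Finset.sum_eq_zero_iff_of_nonneg fun p _ => hnn _ _] at hx
    have hbx : b x = φ b := by
      have := hx.1
      rw [hsx] at this
      exact sub_eq_zero.1 (pow_eq_zero_iff two_ne_zero |>.1 this)
    have hxK : x ∈ K N := K.mem_iff_find_le.2 (by
      have := hb x
      rw [Set.mem_Ici, hbx] at this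
      exact_mod_cast this.trans hN)
    obtain ⟨p, hp, hpx⟩ := Set.mem_iUnion₂.1 (hT.2 hxK)
    exact hpx (hx.2 p hp)
  let g' : C^∞⟮𝓡 n, M; ℝ⟯ := ⟨fun x => (g x)⁻¹, fun x => g.contMDiff.contMDiffAt.inv₀ (hg x)⟩
  have h1 : g * g' = 1 := by
    ext x
    exact mul_inv_cancel₀ (hg x)
  have h2 : φ g = 0 := by
    simp only [g, map_add, map_sum, hs, Finset.sum_const_zero, add_zero]
  have := congrArg φ h1
  rw [map_mul, h2, zero_mul, map_one] at this
  exact zero_ne_one this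

end Manifold

/-! ### Base points of jets, locality -/

section Jets

open Filter Topology

variable {n r : ℕ} {M : Type*} [TopologicalSpace M] [ChartedSpace (EuclideanSpace ℝ (Fin n)) M]

lemma lift_add (f g : C^∞⟮𝓡 n, M; ℝ⟯) (j : ℕ) (u : TJet n r M) :
    lift (f + g) j u = lift f j u + lift g j u := by
  rw [lift, map_add, TruncAlg.coeff_add]; rfl

lemma lift_smul (k : ℝ) (f : C^∞⟮𝓡 n, M; ℝ⟯) (j : ℕ) (u : TJet n r M) :
    lift (k • f) j u = k * lift f j u := by
  rw [lift, map_smul, TruncAlg.coeff_smul]; rfl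

lemma lift_mul (f g : C^∞⟮𝓡 n, M; ℝ⟯) {j : ℕ} (hj : j ≤ r) (u : TJet n r M) :
    lift (f * g) j u =
      ∑ p ∈ Finset.HasAntidiagonal.antidiagonal j, lift f p.1 u * lift g p.2 u := by
  rw [lift, map_mul, TruncAlg.coeff_mul hj]; rfl

lemma jet_ext {u v : TJet n r M} (h : ∀ f, ∀ j ≤ r, lift f j u = lift f j v) : u = v :=
  AlgHom.ext fun f => TruncAlg.ext_coeff fun j hj => h f j hj

lemma lift_zeroJet (f : C^∞⟮𝓡 n, M; ℝ⟯) (j : ℕ) (m : M) :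
    lift f j (zeroJet m : TJet n r M) = if j = 0 then f m else 0 :=
  TruncAlg.coeff_algebraMap j (f m)

lemma isInducing_lift : IsInducing (fun (u : TJet n r M)
    (q : C^∞⟮𝓡 n, M; ℝ⟯ × Fin (r + 1)) => lift q.1 q.2 u) := ⟨rfl⟩

lemma continuousOn_of_lift {Z : Type*} [TopologicalSpace Z] {γ : Z → TJet n r M} {s : Set Z}
    (h : ∀ (f : C^∞⟮𝓡 n, M; ℝ⟯) (j : Fin (r + 1)), ContinuousOn (fun z => lift f j (γ z)) s) :
    ContinuousOn γ s := by
  refine (isInducing_lift (n := n) (r := r) (M := M)).continuousOn_iff.2 ?_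
  exact continuousOn_pi.2 fun q => h q.1 q.2

lemma continuous_lift (f : C^∞⟮𝓡 n, M; ℝ⟯) (j : Fin (r + 1)) :
    Continuous fun u : TJet n r M => lift f j u :=
  (continuous_apply (f, j)).comp isInducing_lift.continuous

variable [T2Space M] [SecondCountableTopology M] [IsManifold (𝓡 n) ∞ M]

lemma exists_pt (u : TJet n r M) : ∃ p : M, ∀ f, lift f 0 u = f p :=
  exists_eq_eval ((TruncAlg.aug r).comp u)

/-- The base point of a jet. -/
def pt (u : TJet n r M) : M := (exists_pt u).choose

lemma lift_zero (f : C^∞⟮𝓡 n, M; ℝ⟯) (u : TJet n r M) : lift f 0 u = f (pt u) :=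
  (exists_pt u).choose_spec f

lemma pt_eq {u : TJet n r M} {q : M} (h : ∀ f : C^∞⟮𝓡 n, M; ℝ⟯, lift f 0 u = f q) : pt u = q := by
  by_contra hne
  obtain ⟨χ, h1, hs⟩ := exists_bump (n := n) (isClosed_singleton (x := q)).isOpen_compl hne
  have h0 : χ q = 0 := image_eq_zero_of_notMem_tsupport fun hq => hs hq rfl
  have := h χ
  rw [lift_zero, h1.self_of_nhds, h0] at this
  exact one_ne_zero this

lemma pt_zeroJet (m : M) : pt (zeroJet m : TJet n r M) = m :=
  pt_eq fun f => by simp [lift_zeroJet]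

lemma kappa_zero (u : TJet n r M) : kappa 0 u = zeroJet (pt u) :=
  jet_ext fun f j _ => by
    rw [lift_zeroJet, ← lift_zero]
    exact TruncAlg.coeff_scaling_zero j (u f)

lemma sub_const_mem_order (u : TJet n r M) (f : C^∞⟮𝓡 n, M; ℝ⟯) :
    u (f - algebraMap ℝ _ (f (pt u))) ∈ TruncAlg.order r 1 := by
  intro j hj
  obtain rfl : j = 0 := by omega
  have := lift_zero (f - algebraMap ℝ _ (f (pt u))) u
  exact this.trans (sub_self _)

/-- A jet only depends on germs at its base point. -/
lemma apply_eq_of_eventuallyEq (u : TJet n r M) {f g : C^∞⟮𝓡 n, M; ℝ⟯}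
    (h : ∀ᶠ x in 𝓝 (pt u), f x = g x) : u f = u g := by
  rw [← sub_eq_zero, ← map_sub]
  obtain ⟨U, hU, hUo, hmU⟩ := eventually_nhds_iff.1 h
  obtain ⟨χ, hχ1, hχs⟩ := exists_bump (n := n) hUo hmU
  -- the jet of `χ - 1` is nilpotent, while multiplication by `1 - χ` fixes `f - g`
  have h0 : (1 - χ) * (f - g) = f - g := by
    ext x
    change (1 - χ x) * (f x - g x) = f x - g x
    by_cases hx : x ∈ U
    · simp [hU x hx]
    · have : χ x = 0 := image_eq_zero_of_notMem_tsupport fun h => hx (hχs h)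
      simp [this]
  have hpow : ∀ k : ℕ, (1 - χ) ^ k * (f - g) = f - g := fun k => by
    induction k with
    | zero => simp
    | succ k ih => rw [pow_succ, mul_assoc, h0, ih]
  have h1 : u (1 - χ) ∈ TruncAlg.order r 1 := by
    intro j hj
    obtain rfl : j = 0 := by omega
    refine (lift_zero (1 - χ) u).trans ?_
    change 1 - χ (pt u) = 0
    rw [hχ1.self_of_nhds, sub_self]
  have h2 := TruncAlg.pow_mem_order h1 (r + 1)
  rw [mul_one] at h2
  rw [← hpow (r + 1), map_mul, map_pow, TruncAlg.eq_zero_of_mem_order h2, zero_mul]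

/-- A jet is determined by its base point and its values on coordinates. -/
lemma jet_eq (c : ExtChart n M) {u v : TJet n r M} (hp : pt u = pt v) (hu : pt u ∈ c.e.source)
    (hX : ∀ a, u (c.X a) = v (c.X a)) : u = v := by
  have key : ∀ k f, u f - v f ∈ TruncAlg.order r k := by
    intro k
    induction k with
    | zero => exact fun f => TruncAlg.order_zero _
    | succ k ih =>
      intro f
      obtain ⟨g, hg⟩ := c.hadamard Finset.univ hu (f - algebraMap ℝ _ (f (pt u))) (by
        have hev : ∀ᶠ x in 𝓝 (pt u), x ∈ c.e.source := c.e.open_source.mem_nhds hu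
        filter_upwards [hev] with x hx h
        have : c.e x = c.e (pt u) := by
          ext a
          rw [← c.X_eq a x hx, ← c.X_eq a _ hu, h a (Finset.mem_univ a)]
        rw [c.e.injOn hx hu this]
        exact sub_self (f (pt u)))
      have hg' : ∀ᶠ x in 𝓝 (pt u), (f - algebraMap ℝ _ (f (pt u)) : C^∞⟮𝓡 n, M; ℝ⟯) x =
          (∑ a, (c.X a - algebraMap ℝ _ (c.X a (pt u))) * g a : C^∞⟮𝓡 n, M; ℝ⟯) x := by
        filter_upwards [hg] with x hx
        rw [hx, eval_sum]
        rfl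
      have h1 := apply_eq_of_eventuallyEq u hg'
      have h2 := apply_eq_of_eventuallyEq v
        (f := f - algebraMap ℝ _ (f (pt u)))
        (g := ∑ a, (c.X a - algebraMap ℝ _ (c.X a (pt u))) * g a) (by rw [← hp]; exact hg')
      simp only [map_sub, map_sum, map_mul, AlgHom.commutes] at h1 h2
      have h3 : u f - v f = ∑ a, (u (c.X a) - algebraMap ℝ _ (c.X a (pt u))) *
          (u (g a) - v (g a)) := by
        rw [sub_eq_iff_eq_add.1 h1, sub_eq_iff_eq_add.1 h2, add_sub_add_right_eq_sub,
          ← Finset.sum_sub_distrib]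
        refine Finset.sum_congr rfl fun a _ => ?_
        rw [← hX a, mul_sub]
      rw [h3]
      refine Ideal.sum_mem _ fun a _ => ?_
      have h4 := sub_const_mem_order u (c.X a)
      rw [map_sub, AlgHom.commutes] at h4
      rw [add_comm k 1]
      exact TruncAlg.mul_mem_order h4 (ih (g a))
  ext f
  exact sub_eq_zero.1 (TruncAlg.eq_zero_of_mem_order (key (r + 1) f))

end Jets

/-! ### Jets with prescribed coordinates -/

section Prolong

open Finset.HasAntidiagonal

variable {n r : ℕ}

/-- The vector field `∑ (j + 1) ξ_{a,j+1} ∂ / ∂ ξ_{a,j}` (where `ξ_{a,r+1} = 0`) on the space of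
coordinates `ξ_{a,j}` of `r`-jets, `0 ≤ j ≤ r`. It is the total derivative: it describes how the
Taylor coefficients of `t ↦ ∑ ξ_j t ^ j` change along the curve. -/
def totalField (ξ : Fin n × Fin (r + 1) → ℝ) : Fin n × Fin (r + 1) → ℝ :=
  fun p => if h : (p.2 : ℕ) + 1 < r + 1 then ((p.2 : ℕ) + 1 : ℝ) * ξ (p.1, ⟨p.2 + 1, h⟩) else 0

/-- The functions `D ^ j G / j!` for the derivation `D` given by `totalField`. If `G` is a function
of the base coordinates `ξ_{a,0}`, this is the `j`-th Taylor coefficient at `t = 0` of `G` along the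
curve `∑ ξ_j t ^ j`. -/
def taylorCoeff (G : (Fin n × Fin (r + 1) → ℝ) → ℝ) : ℕ → (Fin n × Fin (r + 1) → ℝ) → ℝ
  | 0 => G
  | j + 1 => fun ξ => ((j : ℝ) + 1)⁻¹ * fderiv ℝ (taylorCoeff G j) ξ (totalField ξ)

lemma contDiff_totalField : ContDiff ℝ ∞ (totalField (n := n) (r := r)) := by
  rw [contDiff_pi]
  intro p
  unfold totalField
  split_ifs with h
  · exact contDiff_const.mul (contDiff_apply ℝ ℝ _)
  · exact contDiff_const

variable {Ω : Set (Fin n × Fin (r + 1) → ℝ)}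

lemma contDiffOn_taylorCoeff (hΩ : IsOpen Ω) {G : (Fin n × Fin (r + 1) → ℝ) → ℝ}
    (hG : ContDiffOn ℝ ∞ G Ω) (j : ℕ) : ContDiffOn ℝ ∞ (taylorCoeff G j) Ω := by
  induction j with
  | zero => exact hG
  | succ j ih =>
    exact contDiffOn_const.mul
      ((ih.fderiv_of_isOpen hΩ (by norm_cast)).clm_apply contDiff_totalField.contDiffOn)

lemma taylorCoeff_congr (hΩ : IsOpen Ω) {G G' : (Fin n × Fin (r + 1) → ℝ) → ℝ}
    (h : Set.EqOn G G' Ω) (j : ℕ) : Set.EqOn (taylorCoeff G j) (taylorCoeff G' j) Ω := by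
  induction j with
  | zero => exact h
  | succ j ih =>
    intro ξ hξ
    have : taylorCoeff G j =ᶠ[nhds ξ] taylorCoeff G' j := ih.eventuallyEq_of_mem (hΩ.mem_nhds hξ)
    simp only [taylorCoeff, this.fderiv_eq]

lemma differentiableAt_taylorCoeff (hΩ : IsOpen Ω) {G : (Fin n × Fin (r + 1) → ℝ) → ℝ}
    (hG : ContDiffOn ℝ ∞ G Ω) (j : ℕ) {ξ} (hξ : ξ ∈ Ω) :
    DifferentiableAt ℝ (taylorCoeff G j) ξ :=
  ((contDiffOn_taylorCoeff hΩ hG j).contDiffAt (hΩ.mem_nhds hξ)).differentiableAt (by simp)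

lemma taylorCoeff_add (hΩ : IsOpen Ω) {G G' : (Fin n × Fin (r + 1) → ℝ) → ℝ}
    (hG : ContDiffOn ℝ ∞ G Ω) (hG' : ContDiffOn ℝ ∞ G' Ω) (j : ℕ) :
    ∀ ξ ∈ Ω, taylorCoeff (fun ξ => G ξ + G' ξ) j ξ = taylorCoeff G j ξ + taylorCoeff G' j ξ := by
  induction j with
  | zero => exact fun _ _ => rfl
  | succ j ih =>
    intro ξ hξ
    have : taylorCoeff (fun ξ => G ξ + G' ξ) j =ᶠ[nhds ξ] taylorCoeff G j + taylorCoeff G' j :=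
      Set.EqOn.eventuallyEq_of_mem ih (hΩ.mem_nhds hξ)
    simp only [taylorCoeff]
    rw [this.fderiv_eq, fderiv_add (differentiableAt_taylorCoeff hΩ hG j hξ)
      (differentiableAt_taylorCoeff hΩ hG' j hξ), add_apply, mul_add]

lemma taylorCoeff_const (k : ℝ) (j : ℕ) (ξ : Fin n × Fin (r + 1) → ℝ) :
    taylorCoeff (fun _ => k) j ξ = if j = 0 then k else 0 := by
  induction j generalizing ξ with
  | zero => rfl
  | succ j ih =>
    have : taylorCoeff (fun _ => k) j = fun _ : Fin n × Fin (r + 1) → ℝ => if j = 0 then k else 0 :=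
      funext ih
    simp [taylorCoeff, this]

/-- Leibniz' rule for the Taylor coefficients. -/
lemma taylorCoeff_mul (hΩ : IsOpen Ω) {G G' : (Fin n × Fin (r + 1) → ℝ) → ℝ}
    (hG : ContDiffOn ℝ ∞ G Ω) (hG' : ContDiffOn ℝ ∞ G' Ω) (j : ℕ) :
    ∀ ξ ∈ Ω, taylorCoeff (fun ξ => G ξ * G' ξ) j ξ =
      ∑ p ∈ antidiagonal j, taylorCoeff G p.1 ξ * taylorCoeff G' p.2 ξ := by
  induction j with
  | zero => exact fun _ _ => by simp [taylorCoeff]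
  | succ j ih =>
    intro ξ hξ
    have h1 : taylorCoeff (fun ξ => G ξ * G' ξ) j =ᶠ[nhds ξ]
        fun ξ => ∑ p ∈ antidiagonal j, taylorCoeff G p.1 ξ * taylorCoeff G' p.2 ξ :=
      Set.EqOn.eventuallyEq_of_mem ih (hΩ.mem_nhds hξ)
    have hd := fun k => differentiableAt_taylorCoeff hΩ hG k hξ
    have hd' := fun k => differentiableAt_taylorCoeff hΩ hG' k hξ
    have hs : ∀ (F : (Fin n × Fin (r + 1) → ℝ) → ℝ) (k : ℕ),
        fderiv ℝ (taylorCoeff F k) ξ (totalField ξ) = ((k : ℝ) + 1) * taylorCoeff F (k + 1) ξ := by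
      intro F k
      have : ((k : ℝ) + 1) ≠ 0 := by positivity
      rw [taylorCoeff, mul_inv_cancel_left₀ this]
    have h2 : fderiv ℝ (taylorCoeff (fun ξ => G ξ * G' ξ) j) ξ (totalField ξ) =
        ∑ p ∈ antidiagonal j,
          (((p.1 : ℝ) + 1) * (taylorCoeff G (p.1 + 1) ξ * taylorCoeff G' p.2 ξ) +
            ((p.2 : ℝ) + 1) * (taylorCoeff G p.1 ξ * taylorCoeff G' (p.2 + 1) ξ)) := by
      rw [h1.fderiv_eq, fderiv_fun_sum fun p _ => (hd p.1).fun_mul (hd' p.2),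
        sum_apply]
      refine Finset.sum_congr rfl fun p _ => ?_
      rw [fderiv_fun_mul (hd p.1) (hd' p.2)]
      simp only [add_apply, smul_apply, smul_eq_mul, hs]
      ring
    have h3 : ((j : ℝ) + 1) * ∑ p ∈ antidiagonal (j + 1),
        taylorCoeff G p.1 ξ * taylorCoeff G' p.2 ξ =
        ∑ p ∈ antidiagonal (j + 1), (p.1 : ℝ) * (taylorCoeff G p.1 ξ * taylorCoeff G' p.2 ξ) +
        ∑ p ∈ antidiagonal (j + 1), (p.2 : ℝ) * (taylorCoeff G p.1 ξ * taylorCoeff G' p.2 ξ) := by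
      rw [Finset.mul_sum, ← Finset.sum_add_distrib]
      refine Finset.sum_congr rfl fun p hp => ?_
      have : ((p.1 + p.2 : ℕ) : ℝ) = ((j + 1 : ℕ) : ℝ) := by rw [mem_antidiagonal.1 hp]
      push_cast at this
      rw [← this]
      ring
    have hj : ((j : ℝ) + 1) ≠ 0 := by positivity
    change ((j : ℝ) + 1)⁻¹ * _ = _
    rw [h2, inv_mul_eq_iff_eq_mul₀ hj, h3, Finset.sum_add_distrib]
    congr 1
    · rw [Finset.Nat.antidiagonal_succ]
      simp
    · rw [Finset.Nat.antidiagonal_succ']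
      simp

lemma taylorCoeff_apply (a : Fin n) (j : ℕ) (hj : j < r + 1) :
    taylorCoeff (fun ξ : Fin n × Fin (r + 1) → ℝ => ξ (a, 0)) j = fun ξ => ξ (a, ⟨j, hj⟩) := by
  induction j with
  | zero => rfl
  | succ j ih =>
    have hd : fderiv ℝ (fun ξ : Fin n × Fin (r + 1) → ℝ => ξ (a, ⟨j, by omega⟩)) =
        fun _ => ContinuousLinearMap.proj (a, ⟨j, by omega⟩) :=
      funext fun ξ => (ContinuousLinearMap.proj (R := ℝ) (φ := fun _ : Fin n × Fin (r + 1) => ℝ)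
        (a, ⟨j, by omega⟩)).fderiv
    funext ξ
    rw [taylorCoeff, ih (by omega), hd]
    have : ((j : ℝ) + 1) ≠ 0 := by positivity
    simp [totalField, hj, this]

variable {M : Type*} [TopologicalSpace M] [ChartedSpace (EuclideanSpace ℝ (Fin n)) M]

/-- The base coordinates of a jet. -/
def baseCoord (ξ : Fin n × Fin (r + 1) → ℝ) : EuclideanSpace ℝ (Fin n) :=
  WithLp.toLp 2 fun a => ξ (a, 0)

lemma contDiff_baseCoord : ContDiff ℝ ∞ (baseCoord (n := n) (r := r)) := by
  rw [contDiff_euclidean]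
  exact fun a => contDiff_apply ℝ ℝ (a, (0 : Fin (r + 1)))

namespace ExtChart

variable (c : ExtChart n M)

variable (r) in
/-- The coordinates of the jets with base point in the domain of the chart. -/
def jetTarget : Set (Fin n × Fin (r + 1) → ℝ) := baseCoord ⁻¹' c.e.target

lemma isOpen_jetTarget : IsOpen (c.jetTarget r) :=
  c.e.open_target.preimage contDiff_baseCoord.continuous

lemma contDiffOn_base (f : C^∞⟮𝓡 n, M; ℝ⟯) :
    ContDiffOn ℝ ∞ (fun ξ => f (c.e.symm (baseCoord ξ))) (c.jetTarget r) :=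
  (c.contDiffOn_comp_symm f).comp contDiff_baseCoord.contDiffOn fun _ h => h

/-- The jet with coordinates `ξ`. -/
def jet {ξ : Fin n × Fin (r + 1) → ℝ} (hξ : ξ ∈ c.jetTarget r) : TJet n r M where
  toFun f := TruncAlg.ofCoeff r fun j => taylorCoeff (fun ξ => f (c.e.symm (baseCoord ξ))) j ξ
  map_one' := TruncAlg.ext_coeff fun j hj => by
    rw [TruncAlg.coeff_ofCoeff _ hj, TruncAlg.coeff_one]
    exact taylorCoeff_const 1 j ξ
  map_zero' := TruncAlg.ext_coeff fun j hj => by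
    rw [TruncAlg.coeff_ofCoeff _ hj, TruncAlg.coeff_zero]
    exact (taylorCoeff_const 0 j ξ).trans (ite_self 0)
  map_mul' f g := TruncAlg.ext_coeff fun j hj => by
    rw [TruncAlg.coeff_ofCoeff _ hj, TruncAlg.coeff_mul hj]
    refine (taylorCoeff_mul c.isOpen_jetTarget (c.contDiffOn_base f) (c.contDiffOn_base g) j ξ
      hξ).trans (Finset.sum_congr rfl fun p hp => ?_)
    have := mem_antidiagonal.1 hp
    rw [TruncAlg.coeff_ofCoeff _ (by omega), TruncAlg.coeff_ofCoeff _ (by omega)]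
  map_add' f g := TruncAlg.ext_coeff fun j hj => by
    rw [TruncAlg.coeff_add, TruncAlg.coeff_ofCoeff _ hj, TruncAlg.coeff_ofCoeff _ hj,
      TruncAlg.coeff_ofCoeff _ hj]
    exact taylorCoeff_add c.isOpen_jetTarget (c.contDiffOn_base f) (c.contDiffOn_base g) j ξ hξ
  commutes' k := TruncAlg.ext_coeff fun j hj => by
    rw [TruncAlg.coeff_ofCoeff _ hj, TruncAlg.coeff_algebraMap]
    exact taylorCoeff_const k j ξ

variable {c} in
lemma lift_jet {ξ : Fin n × Fin (r + 1) → ℝ} (hξ : ξ ∈ c.jetTarget r) (f : C^∞⟮𝓡 n, M; ℝ⟯)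
    {j : ℕ} (hj : j ≤ r) :
    lift f j (c.jet hξ) = taylorCoeff (fun ξ => f (c.e.symm (baseCoord ξ))) j ξ :=
  TruncAlg.coeff_ofCoeff _ hj

lemma lift_X_jet {ξ : Fin n × Fin (r + 1) → ℝ} (hξ : ξ ∈ c.jetTarget r) (a : Fin n)
    (j : Fin (r + 1)) : lift (c.X a) j (c.jet hξ) = ξ (a, j) := by
  rw [lift_jet hξ _ (Nat.lt_succ_iff.1 j.2)]
  have h : Set.EqOn (fun ξ : Fin n × Fin (r + 1) → ℝ => c.X a (c.e.symm (baseCoord ξ)))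
      (fun ξ => ξ (a, 0)) (c.jetTarget r) := fun ξ hξ => by
    change c.X a (c.e.symm (baseCoord ξ)) = ξ (a, 0)
    rw [c.X_eq a _ (c.e.map_target hξ), c.e.right_inv hξ]
    rfl
  rw [taylorCoeff_congr c.isOpen_jetTarget h j hξ, taylorCoeff_apply a j j.2]

open Classical in
/-- The jet with coordinates `ξ`, with a junk value outside of `jetTarget`. -/
def jetInv (m : M) (ξ : Fin n × Fin (r + 1) → ℝ) : TJet n r M :=
  if hξ : ξ ∈ c.jetTarget r then c.jet hξ else zeroJet m

lemma jetInv_of_mem (m : M) {ξ : Fin n × Fin (r + 1) → ℝ} (hξ : ξ ∈ c.jetTarget r) :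
    c.jetInv m ξ = c.jet hξ := dif_pos hξ

/-- The coordinates of a jet. -/
def jetCoord (u : TJet n r M) (p : Fin n × Fin (r + 1)) : ℝ := lift (c.X p.1) p.2 u

lemma continuous_jetCoord : Continuous (c.jetCoord (r := r)) := by
  refine continuous_pi fun p => ?_
  exact continuous_lift (c.X p.1) p.2

lemma contDiffOn_lift_jetInv (m : M) (f : C^∞⟮𝓡 n, M; ℝ⟯) (j : Fin (r + 1)) :
    ContDiffOn ℝ ∞ (fun ξ => lift f j (c.jetInv m ξ)) (c.jetTarget r) :=
  (contDiffOn_taylorCoeff c.isOpen_jetTarget (c.contDiffOn_base f) j).congr fun ξ hξ => by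
    rw [c.jetInv_of_mem m hξ, lift_jet hξ _ (Nat.lt_succ_iff.1 j.2)]

variable [T2Space M] [SecondCountableTopology M] [IsManifold (𝓡 n) ∞ M]

lemma pt_jet {ξ : Fin n × Fin (r + 1) → ℝ} (hξ : ξ ∈ c.jetTarget r) :
    pt (c.jet hξ) = c.e.symm (baseCoord ξ) :=
  pt_eq fun f => lift_jet hξ f (Nat.zero_le r)

lemma baseCoord_jetCoord {u : TJet n r M} (hu : pt u ∈ c.e.source) :
    baseCoord (c.jetCoord u) = c.e (pt u) := by
  ext a
  rw [← c.X_eq a _ hu, ← lift_zero]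
  rfl

lemma isOpen_pt_preimage {U : Set M} (hU : IsOpen U) : IsOpen {u : TJet n r M | pt u ∈ U} := by
  rw [isOpen_iff_mem_nhds]
  intro u hu
  obtain ⟨χ, h1, hs⟩ := exists_bump (n := n) hU hu
  have h2 := (continuous_lift (r := r) χ 0).continuousAt.preimage_mem_nhds
    (isOpen_ne.mem_nhds (show lift χ ((0 : Fin (r + 1)) : ℕ) u ≠ 0 by
      rw [Fin.val_zero, lift_zero, h1.self_of_nhds]; exact one_ne_zero))
  filter_upwards [h2] with v hv
  rw [Set.mem_preimage, Set.mem_ofPred_eq, Fin.val_zero, lift_zero] at hv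
  exact hs (subset_tsupport _ hv)

/-- The chart of `T_r M` whose coordinates are the lifts of the coordinates of a chart of `M`; the
point `m` only serves to define the inverse outside of the target. -/
def jetChart (m : M) : OpenPartialHomeomorph (TJet n r M) (Fin n × Fin (r + 1) → ℝ) where
  toFun := c.jetCoord
  invFun := c.jetInv m
  source := {u | pt u ∈ c.e.source}
  target := c.jetTarget r
  map_source' u hu := by
    change baseCoord _ ∈ c.e.target
    rw [c.baseCoord_jetCoord hu]
    exact c.e.map_source hu
  map_target' ξ hξ := by
    rw [c.jetInv_of_mem m hξ, Set.mem_ofPred_eq, pt_jet]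
    exact c.e.map_target hξ
  left_inv' u hu := by
    have hξ : c.jetCoord u ∈ c.jetTarget r := by
      change baseCoord _ ∈ c.e.target
      rw [c.baseCoord_jetCoord hu]
      exact c.e.map_source hu
    rw [c.jetInv_of_mem m hξ]
    have hp : pt (c.jet hξ) = pt u := by
      rw [pt_jet, c.baseCoord_jetCoord hu, c.e.left_inv hu]
    refine jet_eq c hp (hp ▸ hu) fun a => TruncAlg.ext_coeff fun j hj => ?_
    exact c.lift_X_jet hξ a ⟨j, Nat.lt_succ_iff.2 hj⟩
  right_inv' ξ hξ := by
    rw [c.jetInv_of_mem m hξ]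
    exact funext fun p => c.lift_X_jet hξ p.1 p.2
  open_source := isOpen_pt_preimage c.e.open_source
  open_target := c.isOpen_jetTarget
  continuousOn_toFun := c.continuous_jetCoord.continuousOn
  continuousOn_invFun := continuousOn_of_lift fun f j =>
    (c.contDiffOn_lift_jetInv m f j).continuousOn

lemma isSmoothChart_jetChart (m : M) : IsSmoothChart (c.jetChart m : OpenPartialHomeomorph
    (TJet n r M) (Fin n × Fin (r + 1) → ℝ)) :=
  ⟨c.contDiffOn_lift_jetInv m, fun _ _ p =>
    ⟨1, fun _ => (c.X p.1, p.2), fun y => y 0, contDiff_apply ℝ ℝ 0, .of_forall fun _ => rfl⟩⟩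

end ExtChart

end Prolong

/-! ### Weighted coordinates -/

section Weighted

open Filter Topology

variable {n r : ℕ} {M : Type*} [TopologicalSpace M] [ChartedSpace (EuclideanSpace ℝ (Fin n)) M]

/-- The restriction of global functions to an open subset. -/
def res (V : Opens M) : C^∞⟮𝓡 n, M; ℝ⟯ →+* C^∞⟮𝓡 n, V; ℝ⟯ where
  toFun f := f.comp ⟨Subtype.val, contMDiff_subtype_val⟩
  map_one' := rfl
  map_mul' _ _ := rfl
  map_zero' := rfl
  map_add' _ _ := rfl

namespace ExtChart

variable (c : ExtChart n M)

/-- The monomial `∏ x_a ^ s_a` in the (globally extended) coordinates. -/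
def mon (s : Fin n →₀ ℕ) : C^∞⟮𝓡 n, M; ℝ⟯ := ∏ a, c.X a ^ s a

lemma mon_add (s t : Fin n →₀ ℕ) : c.mon (s + t) = c.mon s * c.mon t := by
  simp [mon, pow_add, Finset.prod_mul_distrib]

lemma mon_single (a : Fin n) (k : ℕ) : c.mon (Finsupp.single a k) = c.X a ^ k := by
  rw [mon, Finset.prod_eq_single a]
  · simp
  · intro b _ hb
    simp [hb.symm]
  · simp

end ExtChart

/-- The weighted degree of an exponent. -/
def wdeg (w : Fin n → ℕ) (s : Fin n →₀ ℕ) : ℕ := ∑ a, s a * w a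

lemma wdeg_add (w : Fin n → ℕ) (s t : Fin n →₀ ℕ) : wdeg w (s + t) = wdeg w s + wdeg w t := by
  simp [wdeg, add_mul, Finset.sum_add_distrib]

lemma wdeg_single (w : Fin n → ℕ) (a : Fin n) (k : ℕ) : wdeg w (Finsupp.single a k) = k * w a := by
  rw [wdeg, Finset.sum_eq_single a]
  · simp
  · intro b _ hb
    simp [hb.symm]
  · simp

/-- The ideal of `C^∞(M)` generated by the monomials of weighted degree at least `i` in the
extended coordinates. Near points of the chart it has the same germs as `coordIdeal`. -/
def ExtChart.monIdeal (c : ExtChart n M) (w : Fin n → ℕ) (i : ℕ) : Ideal C^∞⟮𝓡 n, M; ℝ⟯ :=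
  Ideal.span (c.mon '' {s | i ≤ wdeg w s})

lemma ExtChart.mon_mem (c : ExtChart n M) {w : Fin n → ℕ} {i : ℕ} {s : Fin n →₀ ℕ}
    (h : i ≤ wdeg w s) : c.mon s ∈ c.monIdeal w i :=
  Ideal.subset_span ⟨s, h, rfl⟩

/-- The monomials of degree exactly `i` that involve only coordinates of positive weight generate
the monomial ideal of degree `i` modulo that of degree `i + 1`. -/
lemma ExtChart.monIdeal_le (c : ExtChart n M) (w : Fin n → ℕ) (i : ℕ) :
    c.monIdeal w i ≤ c.monIdeal w (i + 1) ⊔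
      Ideal.span (c.mon '' {s | wdeg w s = i ∧ ∀ a, w a = 0 → s a = 0}) := by
  classical
  refine Ideal.span_le.2 ?_
  rintro _ ⟨s, hs, rfl⟩
  rcases (show i ≤ wdeg w s from hs).eq_or_lt with h | h
  · refine Ideal.mem_sup_right ?_
    rw [← Finsupp.filter_add_filter_not s (fun a => w a ≠ 0), mon_add]
    refine Ideal.mul_mem_right _ _ (Ideal.subset_span ⟨_, ⟨?_, fun a ha => ?_⟩, rfl⟩)
    · rw [h]
      refine Finset.sum_congr rfl fun a _ => ?_
      by_cases ha : w a = 0 <;> simp [ha]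
    · simp [ha]
  · exact Ideal.mem_sup_left (c.mon_mem h)

lemma ExtChart.apply_mem_order {c : ExtChart n M} {w : Fin n → ℕ} {u : TJet n r M}
    (hu : ∀ a, u (c.X a) ∈ TruncAlg.order r (w a)) {i : ℕ} {g : C^∞⟮𝓡 n, M; ℝ⟯}
    (hg : g ∈ c.monIdeal w i) : u g ∈ TruncAlg.order r i := by
  suffices h : c.monIdeal w i ≤ (TruncAlg.order r i).comap u from h hg
  refine Ideal.span_le.2 ?_
  rintro _ ⟨s, hs, rfl⟩
  change u (∏ a, c.X a ^ s a) ∈ TruncAlg.order r i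
  rw [map_prod]
  simp only [map_pow]
  exact TruncAlg.order_anti hs
    (TruncAlg.prod_mem_order _ fun a _ => TruncAlg.pow_mem_order (hu a) (s a))

variable [IsManifold (𝓡 n) ∞ M]

namespace Weighting

variable (W : Weighting n M r)

lemma hasDegree_iff (i : ℕ) (f : C^∞⟮𝓡 n, M; ℝ⟯) :
    W.HasDegree i f ↔ ∀ p, ∃ V : Opens M, p ∈ V ∧ res V f ∈ W.fil i V := by
  constructor
  · exact fun h p => ⟨⊤, trivial, h⟩
  · intro h
    refine W.fil_local i ⊤ _ fun p _ => ?_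
    obtain ⟨V, hp, hV⟩ := h p
    exact ⟨V, le_top, hp, hV⟩

lemma HasDegree.res_mem {W : Weighting n M r} {i : ℕ} {f : C^∞⟮𝓡 n, M; ℝ⟯} (h : W.HasDegree i f)
    (V : Opens M) : res V f ∈ W.fil i V :=
  W.fil_restrict i le_top _ h

lemma HasDegree.anti {W : Weighting n M r} {i k : ℕ} {f : C^∞⟮𝓡 n, M; ℝ⟯} (h : W.HasDegree k f)
    (hik : i ≤ k) : W.HasDegree i f :=
  antitone_nat_of_succ_le (f := fun i => W.fil i ⊤) (fun i => W.fil_succ_le i ⊤) hik h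

/-- A chart with extended coordinates is weighted if the filtration is, in terms of germs, the one
by the monomial ideals, and the extended coordinates have the right filtration degree. -/
structure IsWeighted (c : ExtChart n M) : Prop where
  hasDegree_X : ∀ a, W.HasDegree (W.w a) (c.X a)
  exists_mem : ∀ i f, W.HasDegree i f → ∀ q ∈ c.e.source,
    ∃ g ∈ c.monIdeal W.w i, ∀ᶠ x in 𝓝 q, f x = g x
  exists_res : ∀ i, ∀ q ∈ c.e.source, ∀ f, ∀ g ∈ c.monIdeal W.w i, (∀ᶠ x in 𝓝 q, f x = g x) →
    ∃ V : Opens M, q ∈ V ∧ res V f ∈ W.fil i V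

variable [T2Space M] [SecondCountableTopology M]

/-- The coordinates of the local model are extended to global functions by a bump function `χ`, and
the chart is shrunk to a neighbourhood on which `χ = 1`. -/
lemma exists_isWeighted (p : M) : ∃ c : ExtChart n M, W.IsWeighted c ∧ p ∈ c.e.source := by
  classical
  obtain ⟨e, he, hp, hfil⟩ := W.exists_chart p
  obtain ⟨χ, hχ1, hχs⟩ := exists_bump (n := n) e.open_source hp
  obtain ⟨O, hO1, hO, hpO⟩ := eventually_nhds_iff.1 hχ1
  have hcoord : ∀ a, ContMDiffOn (𝓡 n) 𝓘(ℝ) ∞ (fun x => e x a) e.source := fun a =>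
    ((contDiff_euclidean.1 contDiff_id a).contMDiff).comp_contMDiffOn
      (contMDiffOn_of_mem_maximalAtlas he)
  let X : Fin n → C^∞⟮𝓡 n, M; ℝ⟯ := fun a => ⟨fun x => χ x * e x a,
    contMDiff_of_tsupport fun x hx => χ.contMDiff.contMDiffAt.mul
      ((hcoord a).contMDiffAt (e.open_source.mem_nhds (hχs (tsupport_mul_subset_left hx))))⟩
  have hsrc : (e.restr O).source = e.source ∩ O := e.restr_source' O hO
  let c : ExtChart n M :=
    { e := e.restr O
      mem_atlas := restr_mem_maximalAtlas (contDiffGroupoid ∞ (𝓡 n)) he hO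
      X := X
      X_eq := fun a q hq => by
        change χ q * e q a = e q a
        rw [hO1 q (hsrc ▸ hq).2, one_mul] }
  let U : Opens M := ⟨e.source, e.open_source⟩
  let x : Fin n → C^∞⟮𝓡 n, U; ℝ⟯ := fun a => ⟨fun q => e q a, fun q =>
    contMDiffAt_subtype_iff.2 ((hcoord a).contMDiffAt (e.open_source.mem_nhds q.2))⟩
  have hresX : ∀ a, res U (X a) = res U χ * x a := fun a => rfl
  have hgen : ∀ (i : ℕ) (s : Fin n → ℕ), i ≤ ∑ a, s a * W.w a →
      ∏ a, x a ^ s a ∈ W.fil i U := fun i s hs => by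
    have h : ∏ a, x a ^ s a ∈ coordIdeal W.w e i := Ideal.subset_span ⟨s, hs, fun q => by
      rw [eval_prod]
      exact Finset.prod_congr rfl fun a _ => eval_pow _ _ _⟩
    rwa [← hfil] at h
  have hmon : ∀ i, ∀ g ∈ c.monIdeal W.w i, res U g ∈ W.fil i U := by
    intro i
    change c.monIdeal W.w i ≤ (W.fil i U).comap (res U)
    refine Ideal.span_le.2 ?_
    rintro _ ⟨s, hs, rfl⟩
    change res U (∏ a, X a ^ s a) ∈ W.fil i U
    rw [map_prod]
    simp only [map_pow, hresX, mul_pow]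
    rw [Finset.prod_mul_distrib]
    exact Ideal.mul_mem_left _ _ (hgen i s hs)
  refine ⟨c, ⟨fun a => ?_, fun i f hf q hq => ?_, fun i q hq f g hg hfg => ?_⟩, ?_⟩
  · -- away from the support of `χ` the extended coordinates vanish
    rw [hasDegree_iff]
    intro q
    by_cases hq : q ∈ e.source
    · refine ⟨U, hq, hmon _ _ ?_⟩
      have h := c.mon_mem (w := W.w) (i := W.w a) (s := Finsupp.single a 1)
        (by rw [wdeg_single, one_mul])
      rwa [c.mon_single, pow_one] at h
    · refine ⟨⟨(tsupport χ)ᶜ, (isClosed_tsupport χ).isOpen_compl⟩, fun h => hq (hχs h), ?_⟩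
      have : res ⟨(tsupport χ)ᶜ, (isClosed_tsupport χ).isOpen_compl⟩ (c.X a) = 0 := by
        ext y
        have hy : χ (y : M) = 0 := image_eq_zero_of_notMem_tsupport y.2
        change χ (y : M) * e (y : M) a = 0
        rw [hy, zero_mul]
      rw [this]
      exact Ideal.zero_mem _
  · have hqU : q ∈ e.source := (hsrc ▸ hq : q ∈ e.source ∩ O).1
    have key : ∀ φ ∈ coordIdeal W.w e i, ∃ g ∈ c.monIdeal W.w i,
        ∀ᶠ y in 𝓝 q, ∀ hy : y ∈ U, φ ⟨y, hy⟩ = g y := by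
      intro φ hφ
      induction hφ using Submodule.span_induction with
      | mem φ h =>
        obtain ⟨s, hs, hφs⟩ := h
        refine ⟨c.mon (Finsupp.equivFunOnFinite.symm s), c.mon_mem hs, ?_⟩
        have hev : ∀ᶠ y in 𝓝 q, y ∈ c.e.source := c.e.open_source.mem_nhds hq
        filter_upwards [hev] with y hy hyU
        rw [hφs, ExtChart.mon, eval_prod]
        refine Finset.prod_congr rfl fun a _ => ?_
        rw [eval_pow, c.X_eq a y hy]
        rfl
      | zero => exact ⟨0, Ideal.zero_mem _, .of_forall fun _ _ => rfl⟩
      | add φ ψ _ _ h1 h2 =>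
        obtain ⟨g1, hg1, he1⟩ := h1
        obtain ⟨g2, hg2, he2⟩ := h2
        refine ⟨g1 + g2, Ideal.add_mem _ hg1 hg2, ?_⟩
        filter_upwards [he1, he2] with y h1 h2 hy
        exact congrArg₂ (· + ·) (h1 hy) (h2 hy)
      | smul k φ _ h =>
        obtain ⟨g, hg, he⟩ := h
        obtain ⟨k', hk'⟩ := exists_extension_opens k hqU
        refine ⟨k' * g, Ideal.mul_mem_left _ _ hg, ?_⟩
        filter_upwards [he, hk'] with y h1 h2 hy
        exact congrArg₂ (· * ·) (h2 hy).symm (h1 hy)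
    have hfU := hf.res_mem U
    rw [hfil] at hfU
    obtain ⟨g, hg, hfg⟩ := key _ hfU
    refine ⟨g, hg, ?_⟩
    filter_upwards [hfg, e.open_source.mem_nhds hqU] with y h hy
    exact h hy
  · have hqU : q ∈ e.source := (hsrc ▸ hq : q ∈ e.source ∩ O).1
    obtain ⟨B, hB, hBo, hqB⟩ := eventually_nhds_iff.1 hfg
    let V : Opens M := ⟨B ∩ e.source, hBo.inter e.open_source⟩
    refine ⟨V, ⟨hqB, hqU⟩, ?_⟩
    have h1 := W.fil_restrict i (show V ≤ U from fun _ h => h.2) _ (hmon i g hg)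
    convert h1 using 1
    ext y
    exact hB y y.2.1
  · change p ∈ (e.restr O).source
    rw [hsrc]
    exact ⟨hp, hpO⟩

variable {W} {c : ExtChart n M}

lemma IsWeighted.apply_mem_order (hc : W.IsWeighted c) {u : TJet n r M} (hp : pt u ∈ c.e.source)
    (hu : ∀ a, u (c.X a) ∈ TruncAlg.order r (W.w a)) {i : ℕ} {f : C^∞⟮𝓡 n, M; ℝ⟯}
    (hf : W.HasDegree i f) : u f ∈ TruncAlg.order r i := by
  obtain ⟨g, hg, hfg⟩ := hc.exists_mem i f hf _ hp
  rw [apply_eq_of_eventuallyEq u hfg]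
  exact ExtChart.apply_mem_order hu hg

/-- In weighted coordinates, `Q` is the coordinate subspace `x_a^{(j)} = 0` for `j < w_a`. -/
lemma IsWeighted.mem_Q_iff (hc : W.IsWeighted c) {u : TJet n r M} (hp : pt u ∈ c.e.source) :
    u ∈ W.Q ↔ ∀ a, u (c.X a) ∈ TruncAlg.order r (W.w a) :=
  ⟨fun h a => h (W.w a) (W.w_le a) _ (hc.hasDegree_X a),
    fun h _ _ _ hf => hc.apply_mem_order hp h hf⟩

/-- The equations that define `Q` hold in all filtration degrees, also in those above `r`. -/
lemma apply_mem_order_of_mem_Q {u : TJet n r M} (hu : u ∈ W.Q) {i : ℕ} {f : C^∞⟮𝓡 n, M; ℝ⟯}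
    (hf : W.HasDegree i f) : u f ∈ TruncAlg.order r i := by
  obtain ⟨c, hc, hp⟩ := W.exists_isWeighted (pt u)
  exact hc.apply_mem_order hp ((hc.mem_Q_iff hp).1 hu) hf

end Weighting

end Weighted

/-! ### Recovering the weighting -/

section Recover

open Filter Topology

variable {n r : ℕ} {M : Type*} [TopologicalSpace M] [ChartedSpace (EuclideanSpace ℝ (Fin n)) M]
  [T2Space M] [SecondCountableTopology M] [IsManifold (𝓡 n) ∞ M] {W : Weighting n M r}
  {c : ExtChart n M}

namespace Weighting

/-- Through a point of the chart where the coordinates of positive weight vanish, `Q` contains the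
jet of the weighted curve `x_a = x_a(q)` for `w_a = 0` and `x_a = z_a t ^ w_a` for `w_a > 0`. -/
lemma IsWeighted.exists_mem_Q (hc : W.IsWeighted c) {q : M} (hq : q ∈ c.e.source)
    (h0 : ∀ a, 0 < W.w a → c.X a q = 0) (z : Fin n → ℝ) :
    ∃ u : TJet n r M, u ∈ W.Q ∧ pt u = q ∧
      ∀ a, 0 < W.w a → u (c.X a) = z a • eps r ^ W.w a := by
  let ξ : Fin n × Fin (r + 1) → ℝ := fun p =>
    if W.w p.1 = 0 then (if (p.2 : ℕ) = 0 then c.X p.1 q else 0)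
    else if (p.2 : ℕ) = W.w p.1 then z p.1 else 0
  have hbase : baseCoord ξ = c.e q := by
    ext a
    rw [← c.X_eq a q hq]
    change ξ (a, 0) = _
    rcases (W.w a).eq_zero_or_pos with h | h
    · simp [ξ, h]
    · simp [ξ, h.ne', h.ne, h0 a h]
  have hξ : ξ ∈ c.jetTarget r := by
    change baseCoord ξ ∈ c.e.target
    rw [hbase]
    exact c.e.map_source hq
  have hpt : pt (c.jet hξ) = q := by rw [c.pt_jet, hbase, c.e.left_inv hq]
  have hX : ∀ a, 0 < W.w a → c.jet hξ (c.X a) = z a • eps r ^ W.w a := fun a ha =>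
    TruncAlg.ext_coeff fun j hj => by
      refine (c.lift_X_jet hξ a ⟨j, Nat.lt_succ_iff.2 hj⟩).trans ?_
      rw [TruncAlg.coeff_smul, TruncAlg.coeff_eps_pow]
      by_cases h : j = W.w a <;> simp [ξ, ha.ne', h, W.w_le a]
  refine ⟨c.jet hξ, (hc.mem_Q_iff (hpt ▸ hq)).2 fun a j hj => ?_, hpt, hX⟩
  rw [hX a (by omega), TruncAlg.coeff_smul, TruncAlg.coeff_eps_pow, if_neg (by omega), mul_zero]

/-- A function whose lifts `f^{(j)}`, `j < i`, vanish on `Q` is locally in the monomial ideal of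
degree `i`, at points where the coordinates of positive weight vanish. Modulo the ideal of degree
`i`, it is a combination of monomials of degree `i - 1`; the lifts of order `i - 1`, evaluated on
weighted curves, show that the coefficients vanish along `N`, so that by Hadamard's lemma they are
combinations of coordinates of positive weight. -/
lemma IsWeighted.exists_mem_monIdeal (hc : W.IsWeighted c) {q : M} (hq : q ∈ c.e.source)
    (h0 : ∀ a, 0 < W.w a → c.X a q = 0) (f : C^∞⟮𝓡 n, M; ℝ⟯) {i : ℕ} (hi : i ≤ r + 1)
    (hf : ∀ j < i, ∀ u : TJet n r M, u ∈ W.Q → lift f j u = 0) :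
    ∃ g ∈ c.monIdeal W.w i, ∀ᶠ x in 𝓝 q, f x = g x := by
  classical
  induction i with
  | zero =>
    refine ⟨f, ?_, .of_forall fun _ => rfl⟩
    have h1 : c.mon 0 ∈ c.monIdeal W.w 0 := c.mon_mem (Nat.zero_le _)
    have h2 : c.mon 0 = 1 := by simp [ExtChart.mon]
    rw [h2] at h1
    rw [(Ideal.eq_top_iff_one _).2 h1]
    trivial
  | succ i ih =>
    obtain ⟨g, hg, hfg⟩ := ih (by omega) fun j hj => hf j (by omega)
    obtain ⟨g₁, hg₁, g₂, hg₂, rfl⟩ := Submodule.mem_sup.1 (c.monIdeal_le W.w i hg)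
    obtain ⟨l, hl, rfl⟩ := (Finsupp.mem_span_image_iff_linearCombination _).1 hg₂
    have hlc : Finsupp.linearCombination C^∞⟮𝓡 n, M; ℝ⟯ c.mon l =
        ∑ s ∈ l.support, l s * c.mon s := rfl
    rw [hlc] at hfg
    have hls : ∀ s ∈ l.support, wdeg W.w s = i ∧ ∀ a, W.w a = 0 → s a = 0 := fun s hs =>
      (Finsupp.mem_supported _ _).1 hl hs
    let A : Finset (Fin n) := Finset.univ.filter fun a => 0 < W.w a
    have hA : ∀ a, a ∈ A ↔ 0 < W.w a := fun a => by simp [A]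
    have hsrc : ∀ᶠ x in 𝓝 q, x ∈ c.e.source := c.e.open_source.mem_nhds hq
    -- the coefficients vanish where the coordinates of positive weight do
    have hvan : ∀ s ∈ l.support, ∀ᶠ x in 𝓝 q, (∀ a ∈ A, c.X a x = c.X a q) → l s x = 0 := by
      intro s hs
      filter_upwards [hsrc, eventually_eventually_nhds.2 hfg] with x hx hfx hxA
      have hx0 : ∀ a, 0 < W.w a → c.X a x = 0 := fun a ha => by
        rw [hxA a ((hA a).2 ha), h0 a ha]
      let P : MvPolynomial (Fin n) ℝ := ∑ s ∈ l.support, MvPolynomial.monomial s (l s x)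
      have hP : P = 0 := by
        refine MvPolynomial.funext fun z => ?_
        obtain ⟨u, huQ, hpt, huX⟩ := hc.exists_mem_Q (r := r) hx hx0 z
        have h1 : (u f).coeff i = 0 := hf i (Nat.lt_succ_self i) u huQ
        rw [apply_eq_of_eventuallyEq u (hpt.symm ▸ hfx), map_add, TruncAlg.coeff_add,
          ExtChart.apply_mem_order ((hc.mem_Q_iff (hpt.symm ▸ hx)).1 huQ) hg₁ i
            (Nat.lt_succ_self i), zero_add, map_sum, TruncAlg.coeff_sum] at h1
        rw [map_zero, map_sum, ← h1]
        refine Finset.sum_congr rfl fun t ht => ?_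
        have hmon : u (c.mon t) = (∏ a, z a ^ t a) • eps r ^ i := by
          have h2 : ∀ a, u (c.X a) ^ t a = z a ^ t a • eps r ^ (t a * W.w a) := by
            intro a
            rcases (W.w a).eq_zero_or_pos with h | h
            · simp [(hls t ht).2 a h]
            · rw [huX a h, smul_pow, ← pow_mul, mul_comm]
          rw [ExtChart.mon, map_prod]
          simp only [map_pow, h2]
          rw [Finset.prod_smul, Finset.prod_pow_eq_pow_sum]
          congr 2
          exact (hls t ht).1
        rw [map_mul, hmon, mul_smul_comm, TruncAlg.coeff_smul,
          TruncAlg.coeff_mul_eps_pow (by omega), MvPolynomial.eval_monomial, mul_comm]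
        have h3 : (u (l t)).coeff 0 = l t x := hpt ▸ lift_zero (l t) u
        rw [h3, Finsupp.prod_fintype _ _ fun _ => pow_zero _]
      have h4 := congrArg (MvPolynomial.coeff s) hP
      simpa [P, MvPolynomial.coeff_sum, MvPolynomial.coeff_monomial,
        Finsupp.mem_support_iff.1 hs] using h4
    -- hence the monomials of degree `i` contribute elements of the ideal of degree `i + 1`
    have hterm : ∀ s, ∃ k ∈ c.monIdeal W.w (i + 1), s ∈ l.support →
        ∀ᶠ x in 𝓝 q, (l s * c.mon s) x = k x := by
      intro s
      by_cases hs : s ∈ l.support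
      · obtain ⟨k, hk⟩ := c.hadamard A hq (l s) (hvan s hs)
        refine ⟨∑ a ∈ A, k a * c.mon (s + Finsupp.single a 1), Ideal.sum_mem _ fun a ha =>
          Ideal.mul_mem_left _ _ (c.mon_mem ?_), fun _ => ?_⟩
        · have := (hA a).1 ha
          rw [wdeg_add, wdeg_single, (hls s hs).1]
          omega
        · filter_upwards [hk] with x hx
          change l s x * c.mon s x = _
          rw [hx, eval_sum, Finset.sum_mul]
          refine Finset.sum_congr rfl fun a ha => ?_
          rw [h0 a ((hA a).1 ha), c.mon_add, c.mon_single, pow_one]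
          change _ = k a x * (c.mon s x * c.X a x)
          ring
      · exact ⟨0, Ideal.zero_mem _, fun h => absurd h hs⟩
    choose k hk hke using hterm
    refine ⟨g₁ + ∑ s ∈ l.support, k s, Ideal.add_mem _ hg₁ (Ideal.sum_mem _ fun s _ => hk s), ?_⟩
    have hall := (l.support.eventually_all (l := 𝓝 q)).2 fun s hs => hke s hs
    filter_upwards [hfg, hall] with x h1 h2
    rw [h1]
    change g₁ x + _ = g₁ x + _
    rw [eval_sum, eval_sum, Finset.sum_congr rfl h2]

/-- Where a coordinate of positive weight is nonzero, the monomial ideals are trivial. -/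
lemma exists_mem_monIdeal_of_ne {a : Fin n} (ha : 0 < W.w a) {q : M} (hqa : c.X a q ≠ 0) (i : ℕ)
    (f : C^∞⟮𝓡 n, M; ℝ⟯) : ∃ g ∈ c.monIdeal W.w i, ∀ᶠ x in 𝓝 q, f x = g x := by
  have hU : IsOpen {x | c.X a x ≠ 0} := isOpen_ne.preimage (c.X a).contMDiff.continuous
  obtain ⟨k, hk⟩ := exists_extension (n := n) (φ := fun x => (c.X a x ^ i)⁻¹ * f x) hU
    (fun x hx => (((c.X a).contMDiff.contMDiffAt.pow i).inv₀ (pow_ne_zero i hx)).mul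
      f.contMDiff.contMDiffAt |>.contMDiffWithinAt) hqa
  refine ⟨k * c.mon (Finsupp.single a i), Ideal.mul_mem_left _ _ (c.mon_mem ?_), ?_⟩
  · rw [wdeg_single]
    exact Nat.le_mul_of_pos_right i ha
  · filter_upwards [hk, hU.mem_nhds hqa] with x hx hxa
    change f x = k x * c.mon (Finsupp.single a i) x
    rw [hx, c.mon_single, eval_pow]
    have : c.X a x ^ i ≠ 0 := pow_ne_zero i hxa
    field_simp

variable (W) in
/-- The filtration degree of a function can be read off from its lifts on `Q`. -/
theorem hasDegree_iff_lift {i : ℕ} (hi : i ≤ r) (f : C^∞⟮𝓡 n, M; ℝ⟯) :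
    W.HasDegree i f ↔ ∀ j < i, ∀ u : TJet n r M, u ∈ W.Q → lift f j u = 0 := by
  refine ⟨fun h j hj u hu => hu i hi f h j hj, fun h => (W.hasDegree_iff i f).2 fun p => ?_⟩
  obtain ⟨c, hc, hp⟩ := W.exists_isWeighted p
  obtain ⟨g, hg, hfg⟩ : ∃ g ∈ c.monIdeal W.w i, ∀ᶠ x in 𝓝 p, f x = g x := by
    by_cases h0 : ∀ a, 0 < W.w a → c.X a p = 0
    · exact hc.exists_mem_monIdeal hp h0 f (by omega) h
    · push Not at h0
      obtain ⟨a, ha, hpa⟩ := h0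
      exact exists_mem_monIdeal_of_ne ha hpa i f
  exact hc.exists_res i p hp f g hg hfg

end Weighting

end Recover

/-! ### Tangent vectors along the zero section -/

section Tangent

variable {n r : ℕ} {M : Type*} [TopologicalSpace M] [ChartedSpace (EuclideanSpace ℝ (Fin n)) M]

lemma hasMFDerivAt_coe (f : C^∞⟮𝓡 n, M; ℝ⟯) (m : M) :
    HasMFDerivAt (𝓡 n) 𝓘(ℝ) f m (mfderiv (𝓡 n) 𝓘(ℝ) f m) :=
  (f.contMDiff.mdifferentiable (by simp) m).hasMFDerivAt

/-- The differential at `m`, evaluated at a tangent vector, as a linear form in the function. -/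
def diffAt (m : M) (x : TangentSpace (𝓡 n) m) : C^∞⟮𝓡 n, M; ℝ⟯ →ₗ[ℝ] ℝ where
  toFun f := (mfderiv (𝓡 n) 𝓘(ℝ) f m x : ℝ)
  map_add' f g := by
    have h := ((hasMFDerivAt_coe f m).add (hasMFDerivAt_coe g m)).mfderiv
    exact congrArg (fun L : TangentSpace (𝓡 n) m →L[ℝ] ℝ => L x) h
  map_smul' k f := by
    have h := ((hasMFDerivAt_coe f m).const_smul k).mfderiv
    exact congrArg (fun L : TangentSpace (𝓡 n) m →L[ℝ] ℝ => L x) h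

lemma diffAt_mul (m : M) (x : TangentSpace (𝓡 n) m) (f g : C^∞⟮𝓡 n, M; ℝ⟯) :
    diffAt m x (f * g) = f m * diffAt m x g + g m * diffAt m x f := by
  have h := ((hasMFDerivAt_coe f m).mul (hasMFDerivAt_coe g m)).mfderiv
  exact congrArg (fun L : TangentSpace (𝓡 n) m →L[ℝ] ℝ => L x) h

/-- The velocity at `0` of the lift `f^{(j)}` along a smooth curve of jets. -/
def velocity {γ : ℝ → TJet n r M} (hγ : IsSmoothCurve γ) (j : Fin (r + 1)) :
    C^∞⟮𝓡 n, M; ℝ⟯ →ₗ[ℝ] ℝ where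
  toFun f := deriv (fun t => lift f j (γ t)) 0
  map_add' f g := by
    have hd := fun f => ((hγ f j).differentiable (by simp)) 0
    simp only [lift_add]
    exact deriv_fun_add (hd f) (hd g)
  map_smul' k f := by
    simp only [lift_smul]
    exact deriv_const_mul k (((hγ f j).differentiable (by simp)) 0)

/-- At a constant jet only the terms with a lift of order `0` survive in the derivative of
`(f g)^{(j)} = ∑ f^{(k)} g^{(j-k)}`. -/
lemma velocity_mul {γ : ℝ → TJet n r M} (hγ : IsSmoothCurve γ) (j : Fin (r + 1)) {m : M}
    (h0 : γ 0 = zeroJet m) (f g : C^∞⟮𝓡 n, M; ℝ⟯) :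
    velocity hγ j (f * g) = f m * velocity hγ j g + g m * velocity hγ j f := by
  have hj := Nat.lt_succ_iff.1 j.2
  have hd : ∀ f : C^∞⟮𝓡 n, M; ℝ⟯, ∀ k ≤ (j : ℕ),
      DifferentiableAt ℝ (fun t => lift f k (γ t)) 0 := fun f k hk =>
    ((hγ f ⟨k, by omega⟩).differentiable (by simp)) 0
  change deriv (fun t => lift (f * g) j (γ t)) 0 = f m * deriv (fun t => lift g j (γ t)) 0 +
    g m * deriv (fun t => lift f j (γ t)) 0
  simp only [lift_mul f g hj]
  have hle : ∀ p ∈ Finset.HasAntidiagonal.antidiagonal (j : ℕ), p.1 ≤ (j : ℕ) ∧ p.2 ≤ (j : ℕ) := by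
    intro p hp
    have := Finset.HasAntidiagonal.mem_antidiagonal.1 hp
    omega
  rw [deriv_fun_sum fun p hp => (hd f p.1 (hle p hp).1).fun_mul (hd g p.2 (hle p hp).2)]
  have hterm : ∀ p ∈ Finset.HasAntidiagonal.antidiagonal (j : ℕ),
      deriv (fun t => lift f p.1 (γ t) * lift g p.2 (γ t)) 0 =
        (if p.2 = 0 then g m * deriv (fun t => lift f p.1 (γ t)) 0 else 0) +
        (if p.1 = 0 then f m * deriv (fun t => lift g p.2 (γ t)) 0 else 0) := by
    intro p hp
    rw [deriv_fun_mul (hd f p.1 (hle p hp).1) (hd g p.2 (hle p hp).2), h0, lift_zeroJet,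
      lift_zeroJet]
    split_ifs <;> ring
  rw [Finset.sum_congr rfl hterm, Finset.sum_add_distrib, add_comm]
  congr 1
  · rw [Finset.sum_eq_single (0, (j : ℕ))]
    · simp
    · intro p hp hne
      have := Finset.HasAntidiagonal.mem_antidiagonal.1 hp
      rw [if_neg]
      intro h
      exact hne (Prod.ext h (by simp only; omega))
    · intro h
      exact absurd (Finset.HasAntidiagonal.mem_antidiagonal.2 (zero_add _)) h
  · rw [Finset.sum_eq_single ((j : ℕ), 0)]
    · simp
    · intro p hp hne
      have := Finset.HasAntidiagonal.mem_antidiagonal.1 hp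
      rw [if_neg]
      intro h
      exact hne (Prod.ext (by simp only; omega) h)
    · intro h
      exact absurd (Finset.HasAntidiagonal.mem_antidiagonal.2 (add_zero _)) h

/-- In an open subset of a normed space there are smooth curves, defined on all of `ℝ`, with
given initial point and velocity. -/
lemma exists_smooth_line {F : Type*} [NormedAddCommGroup F] [NormedSpace ℝ F] {Ω : Set F}
    (hΩ : IsOpen Ω) {x : F} (hx : x ∈ Ω) (v : F) :
    ∃ φ : ℝ → ℝ, ContDiff ℝ ∞ φ ∧ φ 0 = 0 ∧ deriv φ 0 = 1 ∧ ∀ t, x + φ t • v ∈ Ω := by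
  have hc : ContinuousAt (fun t : ℝ => x + t • v) 0 := by fun_prop
  have h0 : (fun t : ℝ => x + t • v) 0 ∈ Ω := by simpa using hx
  obtain ⟨δ, hδ, hball⟩ := Metric.mem_nhds_iff.1 (hc.preimage_mem_nhds (hΩ.mem_nhds h0))
  -- the bounded reparametrization `(δ / 2) sin (2 t / δ)` keeps the line inside `Ω`
  refine ⟨fun t => δ / 2 * Real.sin (2 / δ * t), by fun_prop, by simp, ?_, fun t => ?_⟩
  · have h1 : HasDerivAt (fun t : ℝ => 2 / δ * t) (2 / δ) 0 := by
      simpa using (hasDerivAt_id (0 : ℝ)).const_mul (2 / δ)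
    have h2 := (h1.sin.const_mul (δ / 2)).deriv
    rw [h2]
    simp
    field_simp
  · refine hball (mem_ball_zero_iff.2 ?_)
    rw [Real.norm_eq_abs, abs_mul, abs_of_pos (by positivity)]
    have := Real.abs_sin_le_one (2 / δ * t)
    nlinarith

end Tangent

/-! ### The graded subbundle -/

section Subbundle

open Filter Topology

variable {n r : ℕ} {M : Type*} [TopologicalSpace M] [ChartedSpace (EuclideanSpace ℝ (Fin n)) M]
  [IsManifold (𝓡 n) ∞ M]

namespace Weighting

lemma comp_mem_Q {W : Weighting n M r} (Ψ : Lam r) {u : TJet n r M} (hu : u ∈ W.Q) :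
    Ψ.comp u ∈ W.Q :=
  fun i hi f hf => TruncAlg.map_mem_order Ψ (hu i hi f hf)

lemma hasDegree_one_iff {W : Weighting n M r} {N : Set M} (hN : W.IsAlong N)
    (f : C^∞⟮𝓡 n, M; ℝ⟯) : W.HasDegree 1 f ↔ ∀ x ∈ N, f x = 0 :=
  (hN.2 ⊤ _).trans ⟨fun h x hx => h ⟨x, trivial⟩ hx, fun h x hx => h x hx⟩

lemma zeroJet_mem_Q {W : Weighting n M r} {N : Set M} (hN : W.IsAlong N) {m : M} (hm : m ∈ N) :
    zeroJet m ∈ W.Q := by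
  intro i _ f hf j hj
  rw [lift_zeroJet]
  split_ifs
  · exact (hasDegree_one_iff hN f).1 (hf.anti (by omega)) m hm
  · rfl

/-- The number of coordinates `x_a^{(j)}` of `Q`, i.e. with `w_a ≤ j`. -/
lemma card_coord (W : Weighting n M r) :
    (Finset.univ.filter fun p : Fin n × Fin (r + 1) => W.w p.1 ≤ p.2).card =
      ∑ i ∈ Finset.range (r + 1), W.k i := by
  rw [Finset.sum_range, Finset.card_filter, Fintype.sum_prod_type_right]
  exact Finset.sum_congr rfl fun i _ => (Finset.card_filter _ _).symm

variable [T2Space M] [SecondCountableTopology M] {W : Weighting n M r} {N : Set M}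

lemma pt_mem (hN : W.IsAlong N) {u : TJet n r M} (hu : u ∈ W.Q) : pt u ∈ N := by
  by_contra h
  obtain ⟨χ, h1, hs⟩ := exists_bump (n := n) hN.1.isOpen_compl h
  have h2 : W.HasDegree 1 χ := (hasDegree_one_iff hN χ).2 fun x hx =>
    image_eq_zero_of_notMem_tsupport fun h => hs h hx
  have h3 := apply_mem_order_of_mem_Q hu h2 0 one_pos
  have h4 := lift_zero χ u
  rw [h1.self_of_nhds] at h4
  exact zero_ne_one (h3.symm.trans h4)

lemma isSubmanifold_Q (W : Weighting n M r) :
    IsSubmanifold W.Q (∑ i ∈ Finset.range (r + 1), W.k i) := by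
  intro u _
  obtain ⟨c, hc, hp⟩ := W.exists_isWeighted (pt u)
  refine ⟨c.jetChart (pt u), c.isSmoothChart_jetChart _, hp, _, W.card_coord, fun v hv => ?_⟩
  rw [hc.mem_Q_iff hv]
  constructor
  · intro h p hS
    exact h p.1 p.2 (by simpa using hS)
  · intro h a j hj
    have := W.w_le a
    exact h (a, ⟨j, by omega⟩) (by simpa using hj)

theorem isGradedSubbundle_Q (hN : W.IsAlong N) :
    IsGradedSubbundle W.Q N (∑ i ∈ Finset.range (r + 1), W.k i) := by
  refine ⟨W.isSubmanifold_Q, fun t u hu => comp_mem_Q (scaling r t) hu, ?_⟩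
  ext v
  constructor
  · rintro ⟨u, hu, rfl⟩
    exact ⟨pt u, pt_mem hN hu, (kappa_zero u).symm⟩
  · rintro ⟨m, hm, rfl⟩
    exact ⟨zeroJet m, zeroJet_mem_Q hN hm, by rw [kappa_zero, pt_zeroJet]⟩

end Weighting

/-! ### The linear approximation -/

variable [T2Space M] [SecondCountableTopology M] {W : Weighting n M r} {N : Set M}

/-- Tangent vectors to `Q` at a constant jet can be prescribed freely in the coordinates of `Q`. -/
lemma Weighting.IsWeighted.mem_tangentAtZero {c : ExtChart n M} (hc : W.IsWeighted c)
    (hN : W.IsAlong N) {m : M} (hmN : m ∈ N) (hm : m ∈ c.e.source)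
    {X : Fin (r + 1) → TangentSpace (𝓡 n) m}
    (hX : ∀ a, ∀ j : Fin (r + 1), (j : ℕ) < W.w a → diffAt m (X j) (c.X a) = 0) :
    X ∈ tangentAtZero W.Q m := by
  let u₀ : TJet n r M := zeroJet m
  have hu₀ : u₀ ∈ (c.jetChart m : OpenPartialHomeomorph (TJet n r M) _).source := by
    change pt (zeroJet m) ∈ c.e.source
    rwa [pt_zeroJet]
  let ξ₀ : Fin n × Fin (r + 1) → ℝ := c.jetCoord u₀
  let η : Fin n × Fin (r + 1) → ℝ := fun p => diffAt m (X p.2) (c.X p.1)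
  obtain ⟨φ, hφ, hφ0, hφ1, hφt⟩ := exists_smooth_line c.isOpen_jetTarget
    ((c.jetChart m).map_source hu₀ : ξ₀ ∈ c.jetTarget r) η
  let γ : ℝ → TJet n r M := fun t => c.jet (hφt t)
  have hline : ContDiff ℝ ∞ fun t => ξ₀ + φ t • η := contDiff_const.add (hφ.smul contDiff_const)
  have hγ : IsSmoothCurve γ := by
    intro f j
    have h := (c.contDiffOn_lift_jetInv m f j).comp_contDiff hline hφt
    convert h using 2 with t
    exact congrArg (lift f j) (c.jetInv_of_mem m (hφt t)).symm
  have hγX : ∀ a (j : Fin (r + 1)) t, lift (c.X a) j (γ t) = ξ₀ (a, j) + φ t * η (a, j) :=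
    fun a j t => c.lift_X_jet (hφt t) a j
  have hγ0 : γ 0 = zeroJet m := by
    have h1 : c.jetInv m ξ₀ = zeroJet m := (c.jetChart m).left_inv hu₀
    have h2 : ξ₀ + φ 0 • η = ξ₀ := by rw [hφ0, zero_smul, add_zero]
    rw [← h1, ← h2]
    exact (c.jetInv_of_mem m (hφt 0)).symm
  refine ⟨γ, hγ, fun t => ?_, hγ0, fun f j => ?_⟩
  · have hpt : pt (γ t) ∈ c.e.source := by
      rw [c.pt_jet (hφt t)]
      exact c.e.map_target (hφt t)
    refine (hc.mem_Q_iff hpt).2 fun a j hj => ?_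
    have hjr : j < r + 1 := by have := W.w_le a; omega
    have h1 : ξ₀ (a, ⟨j, hjr⟩) = 0 :=
      W.zeroJet_mem_Q hN hmN (W.w a) (W.w_le a) _ (hc.hasDegree_X a) j hj
    have h2 : η (a, ⟨j, hjr⟩) = 0 := hX a ⟨j, hjr⟩ hj
    have h3 := hγX a ⟨j, hjr⟩ t
    rw [h1, h2, mul_zero, add_zero] at h3
    exact h3
  · -- both sides are derivations at `m`, and they agree on coordinates
    have h1 : velocity hγ j - diffAt m (X j) = 0 := by
      refine pointDerivation_eq_zero c hm _ (fun f g => ?_) fun a => ?_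
      · simp only [LinearMap.sub_apply, velocity_mul hγ j hγ0, diffAt_mul]
        ring
      · have h2 : velocity hγ j (c.X a) = η (a, j) := by
          change deriv (fun t => lift (c.X a) j (γ t)) 0 = _
          simp only [hγX]
          rw [deriv_const_add, deriv_mul_const (hφ.differentiable (by simp) 0), hφ1, one_mul]
        rw [LinearMap.sub_apply, h2]
        exact sub_self _
    exact LinearMap.congr_fun (sub_eq_zero.1 h1) f

/-- The tangent space of `Q` at a constant jet `0_m` is the sum of all `F̃_{-j}`. -/
theorem Weighting.mem_tangentAtZero_iff (hN : W.IsAlong N) {m : M} (hm : m ∈ N)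
    (X : Fin (r + 1) → TangentSpace (𝓡 n) m) :
    X ∈ tangentAtZero W.Q m ↔ ∀ j : Fin (r + 1), X j ∈ W.Ftilde j m := by
  constructor
  · rintro ⟨γ, -, hQ, -, hd⟩ j
    simp only [Weighting.Ftilde, Submodule.mem_iInf]
    intro f hf
    have h1 : (fun t => lift f j (γ t)) = fun _ => 0 := funext fun t =>
      apply_mem_order_of_mem_Q (hQ t) hf j (Nat.lt_succ_self _)
    have h2 := hd f j
    rw [h1, deriv_const] at h2
    exact h2.symm
  · intro h
    obtain ⟨c, hc, hp⟩ := W.exists_isWeighted m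
    refine hc.mem_tangentAtZero hN hm hp fun a j hj => ?_
    have h1 := h j
    simp only [Weighting.Ftilde, Submodule.mem_iInf] at h1
    exact h1 (c.X a) ((hc.hasDegree_X a).anti hj)

/-- In degree `-r` all tangent vectors are allowed, since the weights are at most `r`. -/
lemma Weighting.Ftilde_eq_top (hN : W.IsAlong N) {m : M} (hm : m ∈ N) : W.Ftilde r m = ⊤ := by
  classical
  obtain ⟨c, hc, hp⟩ := W.exists_isWeighted m
  refine eq_top_iff.2 fun x _ => ?_
  have h : Pi.single (Fin.last r) x ∈ tangentAtZero W.Q m := by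
    refine hc.mem_tangentAtZero hN hm hp fun a j hj => ?_
    have hne : j ≠ Fin.last r := by
      rintro rfl
      exact absurd (W.w_le a) (by simpa using hj)
    rw [Pi.single_eq_of_ne hne]
    exact map_zero (mfderiv (𝓡 n) 𝓘(ℝ) (c.X a) m)
  have := (Weighting.mem_tangentAtZero_iff hN hm _).1 h (Fin.last r)
  rwa [Pi.single_eq_same] at this

/-- The linear approximation of `Q` is the sum of the `F̃_{-j}` with `j ≥ 1`. -/
theorem Weighting.linApprox_Q (hN : W.IsAlong N) {m : M} (hm : m ∈ N) :
    linApprox W.Q m = {v | ∀ j : Fin r, v j ∈ W.Ftilde (j + 1) m} := by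
  ext v
  constructor
  · rintro ⟨X, hX, hv⟩ j
    rw [← hv j]
    exact (mem_tangentAtZero_iff hN hm X).1 hX j.succ
  · intro h
    refine ⟨Fin.cons 0 v, (mem_tangentAtZero_iff hN hm _).2 fun j => ?_, fun j => rfl⟩
    refine Fin.cases ?_ (fun j => ?_) j
    · exact Submodule.zero_mem _
    · exact h j

/-- A tangent vector to `Q` in the direction of the zero section is tangent to `N`: apply `κ_0` to
a curve that represents it. -/
lemma Weighting.mem_tangentAtZero_zeroJet (hN : W.IsAlong N) {m : M}
    {X : Fin (r + 1) → TangentSpace (𝓡 n) m} (h0 : ∀ j, j ≠ 0 → X j = 0)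
    (hX : X ∈ tangentAtZero W.Q m) :
    X ∈ tangentAtZero (zeroJet '' N : Set (TJet n r M)) m := by
  obtain ⟨γ, hγ, hQ, hγ0, hd⟩ := hX
  have hlift : ∀ (f : C^∞⟮𝓡 n, M; ℝ⟯) (j : Fin (r + 1)) t,
      lift f j (zeroJet (pt (γ t)) : TJet n r M) = if j = 0 then lift f 0 (γ t) else 0 := by
    intro f j t
    rw [lift_zeroJet, lift_zero]
    simp only [Fin.ext_iff, Fin.val_zero]
  refine ⟨fun t => zeroJet (pt (γ t)), fun f j => ?_, fun t => ⟨_, pt_mem hN (hQ t), rfl⟩, ?_,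
    fun f j => ?_⟩
  · simp only [hlift]
    split_ifs
    · exact hγ f 0
    · exact contDiff_const
  · simp only [hγ0, pt_zeroJet]
  · simp only [hlift]
    split_ifs with h
    · subst h
      exact hd f 0
    · rw [deriv_const, h0 j h]
      exact (map_zero (mfderiv (𝓡 n) 𝓘(ℝ) f m)).symm

end Subbundle

end WeightedJets

end

theorem mainTheorem2 {n r : ℕ} {M : Type*} [TopologicalSpace M] [T2Space M]
    [SecondCountableTopology M] [ChartedSpace (EuclideanSpace ℝ (Fin n)) M]
    [IsManifold (𝓡 n) ∞ M] (W : WeightedJets.Weighting n M r) (N : Set M) (hN : W.IsAlong N) :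
    -- `Q` is a graded subbundle over `N` of dimension `k_0 + … + k_r`, and it is `Λ_r`-invariant
    (WeightedJets.IsGradedSubbundle W.Q N (∑ i ∈ Finset.range (r + 1), W.k i) ∧
      ∀ Ψ : WeightedJets.Lam r, ∀ u ∈ W.Q, Ψ.comp u ∈ W.Q) ∧
    -- the linear approximation: `ν(Q, N)` embeds into `TM^{⊕r}|_N`, since the tangent vectors to `Q`
    -- in the directions of the zero section are tangent to `N`, and its image is the sum of the
    -- `F̃_{-j}` for `1 ≤ j ≤ r`; in particular, the component in degree `-r` is all of `TM|_N`
    (∀ m ∈ N,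
      (∀ X : Fin (r + 1) → TangentSpace (𝓡 n) m, (∀ j, j ≠ 0 → X j = 0) →
        X ∈ WeightedJets.tangentAtZero W.Q m →
          X ∈ WeightedJets.tangentAtZero (WeightedJets.zeroJet '' N) m) ∧
      WeightedJets.linApprox W.Q m = {v | ∀ j : Fin r, v j ∈ W.Ftilde (j + 1) m} ∧
      ∀ j : Fin r, (j : ℕ) + 1 = r →
        ∀ x : TangentSpace (𝓡 n) m, Pi.single j x ∈ WeightedJets.linApprox W.Q m) ∧
    -- the weighting is recovered from `Q`
    (∀ i ≤ r, ∀ f : C^∞⟮𝓡 n, M; ℝ⟯,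
      W.HasDegree i f ↔ ∀ j < i, ∀ u ∈ W.Q, WeightedJets.lift f j u = 0) := by
  refine ⟨⟨WeightedJets.Weighting.isGradedSubbundle_Q hN,
    fun Ψ u hu => WeightedJets.Weighting.comp_mem_Q Ψ hu⟩, fun m hm => ⟨fun X h0 hX =>
      WeightedJets.Weighting.mem_tangentAtZero_zeroJet hN h0 hX,
      WeightedJets.Weighting.linApprox_Q hN hm, fun j hj x => ?_⟩,
    fun i hi f => WeightedJets.Weighting.hasDegree_iff_lift W hi f⟩
  rw [WeightedJets.Weighting.linApprox_Q hN hm]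
  intro l
  by_cases h : l = j
  · subst h
    rw [hj, WeightedJets.Weighting.Ftilde_eq_top hN hm]
    trivial
  · rw [Pi.single_eq_of_ne h]
    exact Submodule.zero_mem _
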